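/- Let $X$ be a random vector in $\mathbb{R}^d$ whose law has a density $p_X$ with respect to the Lebesgue measure, and assume that $p_X$ is weakly differentiable with score $\nabla\log p_X$, i.e. there is a measurable vector field, denoted $\nabla \log p_X$, such that $p_X\nabla\log p_X$ is locally integrable and is the distributional gradient of $p_X$ (so $\nabla\log p_X=\nabla p_X/p_X$ almost everywhere on $\{p_X>0\}$). Let $C\in\mathbb{R}$ be such that $$\mathbb{E}\big[\|\nabla\log p_X(X)\|^2\big]\le C .$$ Let $\sigma>0$, let $\varepsilon\sim\mathcal N(0,\sigma^2 I)$ be independent of $X$, and put $Y=X+\varepsilon$. Let $p_Y$ be the continuous density of $Y$ and, for $\alpha\in\mathbb{R}$, let $\varphi_\alpha(y)=y+\alpha\sigma^2\nabla\log p_Y(y)$. Then for every $\alpha\in\mathbb{R}$, $$W_2\big(\mathcal L(X),\mathcal L(\varphi_\alpha(Y))\big)\le\sqrt{\frac{(1+4\alpha^2)\,C}{2}}\;\sigma^2 ,$$ where $W_2(\mu,\nu)=\big(\inf_\Gamma\int\|z_1-z_2\|^2\,d\Gamma(z_1,z_2)\big)^{1/2}$, the infimum being over all measures $\Gamma$ on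 $\mathbb{R}^d\times\mathbb{R}^d$ with marginals $\mu$ and $\nu$. -/

import Mathlib

open MeasureTheory ProbabilityTheory
open scoped ENNReal

noncomputable section

open scoped ContDiff

/-- The real function `p` is a probability density, with respect to the Lebesgue measure, of the
measure `μ` on `ℝ^d`. -/
def IsDensity {d : ℕ} (μ : Measure (EuclideanSpace ℝ (Fin d)))
    (p : EuclideanSpace ℝ (Fin d) → ℝ) : Prop :=
  Measurable p ∧ (∀ x, 0 ≤ p x) ∧ μ = volume.withDensity (fun x => ENNReal.ofReal (p x))

/-- The locally integrable vector field `g` is the weak (distributional) gradient of the locally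
integrable function `f`: `∫ f ∂_v φ = - ∫ φ ⟨g, v⟩` for all test functions `φ ∈ C_c^∞(ℝ^d)` and all
directions `v`. -/
def HasWeakGradient {d : ℕ} (f : EuclideanSpace ℝ (Fin d) → ℝ)
    (g : EuclideanSpace ℝ (Fin d) → EuclideanSpace ℝ (Fin d)) : Prop :=
  LocallyIntegrable f volume ∧ LocallyIntegrable g volume ∧
    ∀ φ : EuclideanSpace ℝ (Fin d) → ℝ, ContDiff ℝ ∞ φ → HasCompactSupport φ →
      ∀ v : EuclideanSpace ℝ (Fin d),
        ∫ x, f x * fderiv ℝ φ x v = - ∫ x, φ x * inner ℝ (g x) v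

/-- The vector field `s` is (a version of) the score `∇ log p` of the density `p`: the density is
weakly differentiable with `∇ p = p • s`. This fixes `s` almost everywhere for the measure
`p(x) dx`, hence `s = ∇p / p` almost everywhere on `{p > 0}`; the values of `s` on `{p = 0}` are
irrelevant. -/
def IsScore {d : ℕ} (p : EuclideanSpace ℝ (Fin d) → ℝ)
    (s : EuclideanSpace ℝ (Fin d) → EuclideanSpace ℝ (Fin d)) : Prop :=
  HasWeakGradient p (fun x => p x • s x)

/-- The `q`-Wasserstein distance of two measures on `ℝ^d`, with values in `[0, ∞]`: the infimum of
`(∫ ‖z₁ - z₂‖^q dΓ)^(1/q)` over all couplings `Γ`. -/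
def wasserstein {d : ℕ} (q : ℝ) (μ ν : Measure (EuclideanSpace ℝ (Fin d))) : ℝ≥0∞ :=
  (⨅ (Γ : Measure (EuclideanSpace ℝ (Fin d) × EuclideanSpace ℝ (Fin d)))
    (_ : Γ.map Prod.fst = μ ∧ Γ.map Prod.snd = ν),
      ∫⁻ z, ‖z.1 - z.2‖ₑ ^ q ∂Γ) ^ (1 / q)

/-- The denoiser `φ_α(y) = y + α σ² ∇ log p(y)`, where `p` is the density of the noisy variable. -/
def denoiser {d : ℕ} (α σ : ℝ) (p : EuclideanSpace ℝ (Fin d) → ℝ)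
    (y : EuclideanSpace ℝ (Fin d)) : EuclideanSpace ℝ (Fin d) :=
  y + (α * σ ^ 2) • gradient (fun z => Real.log (p z)) y

end

/-! Write `p_r` for the density of `X` plus Gaussian noise of variance `r` in every coordinate. The
claim follows from two bounds. First, `W₂(X, Y) ≤ (σ² / 2) √C`. Secondly, `φ_α(Y) - Y` has `L²` norm
`|α| σ² ‖∇ log p_Y(Y)‖ ≤ |α| σ² √C`. Adding them through `‖u + v‖² ≤ 2 ‖u‖² + 2 ‖v‖²` gives `2 (1/4
+ α²) σ⁴ C`, the square of the stated bound.

Both bounds rest on the decrease of Fisher information under Gaussian noise: the score of the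
observation is the conditional expectation of the score of the signal (`IsScore.isNoisyScore`), and
Cauchy–Schwarz does the rest (`lintegral_sq_noisyPartial_div_le`).

For the first bound, one would follow the flow with velocity `-½ ∇ log p_r`, which carries the
solution of the heat equation. No ODE is solved here: the noise is increased one coordinate at a
time. With the other coordinates frozen, the density in coordinate `i` is a heat flow on the line,
and its transport is the explicit monotone rearrangement between distribution functions. The
implicit function theorem gives its velocity (`hasDerivAt_heatTransport`), and Cauchy–Schwarz in
time bounds its cost by a quarter of the elapsed time multiplied by the time integral of the Fisher
information. Each coordinate moves only once, so the squared costs add exactly (`exists_transport`).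

The heat flow is smooth only at positive times. The transport therefore starts at variance `a > 0`;
the initial noise costs at most `√(d a)`, which vanishes as `a → 0`. -/

noncomputable section

open Filter Topology
open scoped NNReal

/-! ### The Gaussian kernel on the line and its distribution function -/

/-- The heat kernel on the line: the density of the centred Gaussian law of variance `r`. -/
def heatKernel (r z : ℝ) : ℝ := (Real.sqrt (2 * Real.pi * r))⁻¹ * Real.exp (-z ^ 2 / (2 * r))

/-- The space derivative of the heat kernel. -/
def heatKernelDeriv (r z : ℝ) : ℝ := -(z / r) * heatKernel r z

/-- The distribution function of the centred Gaussian law of variance `r`. -/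
def heatCDF (r z : ℝ) : ℝ := cdf (gaussianReal 0 1) (z / Real.sqrt r)

lemma heatKernel_nonneg (r z : ℝ) : 0 ≤ heatKernel r z := by
  unfold heatKernel; positivity

lemma heatKernel_pos {r : ℝ} (hr : 0 < r) (z : ℝ) : 0 < heatKernel r z := by
  unfold heatKernel
  have := Real.pi_pos
  positivity

lemma heatKernel_eq_gaussianPDFReal {r : ℝ} (hr : 0 < r) (z : ℝ) :
    heatKernel r z = gaussianPDFReal 0 r.toNNReal z := by
  simp [heatKernel, gaussianPDFReal, hr.le]

lemma measurable_heatKernel : Measurable fun q : ℝ × ℝ => heatKernel q.1 q.2 := by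
  unfold heatKernel; fun_prop

lemma measurable_heatKernelDeriv : Measurable fun q : ℝ × ℝ => heatKernelDeriv q.1 q.2 := by
  unfold heatKernelDeriv heatKernel; fun_prop

lemma measurable_heatCDF : Measurable fun q : ℝ × ℝ => heatCDF q.1 q.2 := by
  unfold heatCDF
  exact (monotone_cdf _).measurable.comp (by fun_prop)

lemma continuousAt_heatKernel {q : ℝ × ℝ} (hq : 0 < q.1) :
    ContinuousAt (fun q : ℝ × ℝ => heatKernel q.1 q.2) q := by
  unfold heatKernel
  have h1 : Real.sqrt (2 * Real.pi * q.1) ≠ 0 := by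
    have := Real.pi_pos; positivity
  have h2 : 2 * q.1 ≠ 0 := by positivity
  fun_prop (disch := assumption)

lemma continuousAt_heatKernelDeriv {q : ℝ × ℝ} (hq : 0 < q.1) :
    ContinuousAt (fun q : ℝ × ℝ => heatKernelDeriv q.1 q.2) q := by
  unfold heatKernelDeriv
  exact ((continuousAt_snd.div continuousAt_fst hq.ne').neg).mul (continuousAt_heatKernel hq)

lemma heatKernel_le {r₀ r : ℝ} (h₀ : 0 < r₀) (hr : r₀ ≤ r) (z : ℝ) :
    heatKernel r z ≤ (Real.sqrt r₀)⁻¹ := by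
  unfold heatKernel
  have hr0 : 0 < r := h₀.trans_le hr
  have h1 : Real.exp (-z ^ 2 / (2 * r)) ≤ 1 := by
    rw [Real.exp_le_one_iff]
    exact div_nonpos_of_nonpos_of_nonneg (by nlinarith [sq_nonneg z]) (by positivity)
  have h2 : (Real.sqrt (2 * Real.pi * r))⁻¹ ≤ (Real.sqrt r₀)⁻¹ := by
    apply inv_anti₀ (by positivity)
    apply Real.sqrt_le_sqrt
    nlinarith [Real.pi_gt_three]
  calc _ ≤ (Real.sqrt r₀)⁻¹ * 1 := by gcongr
    _ = _ := mul_one _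

/-- Follows from `1 + u ≤ exp u` at `u = z² / (2r)`, after completing the square in `|z|`. -/
lemma abs_mul_exp_neg_sq_le {r : ℝ} (hr : 0 < r) (z : ℝ) :
    |z| * Real.exp (-z ^ 2 / (2 * r)) ≤ Real.sqrt r := by
  have h1 := Real.add_one_le_exp (z ^ 2 / (2 * r))
  have h2 : Real.exp (-z ^ 2 / (2 * r)) = (Real.exp (z ^ 2 / (2 * r)))⁻¹ := by
    rw [← Real.exp_neg]; congr 1; ring
  rw [h2, ← div_eq_mul_inv, div_le_iff₀ (Real.exp_pos _)]
  have hs : 0 < Real.sqrt r := Real.sqrt_pos.2 hr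
  refine le_trans ?_ (mul_le_mul_of_nonneg_left h1 hs.le)
  have hsq : Real.sqrt r ^ 2 = r := Real.sq_sqrt hr.le
  obtain ⟨w, hw⟩ : ∃ w, w = Real.sqrt r := ⟨_, rfl⟩
  rw [← hw] at hs hsq ⊢
  have : w * (z ^ 2 / (2 * r) + 1) - |z| = ((|z| - w) ^ 2 + w ^ 2) / (2 * w) := by
    rw [← sq_abs z, ← hsq]
    field_simp
    ring
  have h3 : 0 ≤ ((|z| - w) ^ 2 + w ^ 2) / (2 * w) := by positivity
  linarith

/-- Uniformity in `z` and in `r ≥ r₀` makes this constant a dominating function for differentiation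
under the integral, in time as well as in space. -/
lemma abs_heatKernelDeriv_le {r₀ r : ℝ} (h₀ : 0 < r₀) (hr : r₀ ≤ r) (z : ℝ) :
    |heatKernelDeriv r z| ≤ r₀⁻¹ := by
  have hr0 : 0 < r := h₀.trans_le hr
  refine le_trans ?_ (inv_anti₀ h₀ hr)
  unfold heatKernelDeriv heatKernel
  have hpi := Real.pi_gt_three
  have hg : 0 ≤ (Real.sqrt (2 * Real.pi * r))⁻¹ * Real.exp (-z ^ 2 / (2 * r)) := by positivity
  rw [abs_mul, abs_neg, abs_div, abs_of_pos hr0, abs_of_nonneg hg]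
  have h1 := abs_mul_exp_neg_sq_le hr0 z
  have h2 : (Real.sqrt (2 * Real.pi * r))⁻¹ ≤ (Real.sqrt r)⁻¹ := by
    apply inv_anti₀ (by positivity)
    apply Real.sqrt_le_sqrt
    nlinarith
  have hs : 0 < Real.sqrt r := Real.sqrt_pos.2 hr0
  calc |z| / r * ((Real.sqrt (2 * Real.pi * r))⁻¹ * Real.exp (-z ^ 2 / (2 * r)))
      = r⁻¹ * ((Real.sqrt (2 * Real.pi * r))⁻¹ * (|z| * Real.exp (-z ^ 2 / (2 * r)))) := by
        ring
    _ ≤ r⁻¹ * ((Real.sqrt r)⁻¹ * Real.sqrt r) := by gcongr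
    _ = r⁻¹ := by field_simp

lemma heatCDF_nonneg (r z : ℝ) : 0 ≤ heatCDF r z := cdf_nonneg _ _

lemma heatCDF_le_one (r z : ℝ) : heatCDF r z ≤ 1 := cdf_le_one _ _

lemma integrable_heatKernel {r : ℝ} (hr : 0 < r) : Integrable (heatKernel r) := by
  have : heatKernel r = gaussianPDFReal 0 r.toNNReal :=
    funext fun z => heatKernel_eq_gaussianPDFReal hr z
  rw [this]
  exact integrable_gaussianPDFReal 0 _

lemma hasDerivAt_cdf_gaussian (u : ℝ) :
    HasDerivAt (cdf (gaussianReal 0 1)) (heatKernel 1 u) u := by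
  have hc : Continuous (heatKernel 1) := by unfold heatKernel; fun_prop
  have hint := integrable_heatKernel one_pos
  have h1 : ∀ v, cdf (gaussianReal 0 1) v = ∫ x in Set.Iic v, heatKernel 1 x := by
    intro v
    rw [cdf_eq_real, measureReal_def, gaussianReal_apply_eq_integral 0 one_ne_zero,
      ENNReal.toReal_ofReal (by
        apply integral_nonneg; intro; exact gaussianPDFReal_nonneg _ _ _)]
    simp [heatKernel_eq_gaussianPDFReal one_pos]
  have h2 : (cdf (gaussianReal 0 1) : ℝ → ℝ) =
      fun v => cdf (gaussianReal 0 1) 0 + ∫ x in (0 : ℝ)..v, heatKernel 1 x := by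
    ext v
    rw [h1, h1, ← intervalIntegral.integral_Iic_sub_Iic hint.integrableOn hint.integrableOn]
    ring
  rw [h2]
  exact (intervalIntegral.integral_hasDerivAt_right (hc.intervalIntegrable _ _)
    (hc.stronglyMeasurableAtFilter _ _) hc.continuousAt).const_add _

lemma heatKernel_eq_scale {r : ℝ} (hr : 0 < r) (z : ℝ) :
    heatKernel r z = heatKernel 1 (z / Real.sqrt r) / Real.sqrt r := by
  unfold heatKernel
  have h : -(z / Real.sqrt r) ^ 2 / (2 * 1) = -z ^ 2 / (2 * r) := by
    rw [div_pow, Real.sq_sqrt hr.le]; field_simp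
  rw [h, Real.sqrt_mul (by positivity), mul_one]
  field_simp

lemma hasDerivAt_heatCDF_snd {r : ℝ} (hr : 0 < r) (z : ℝ) :
    HasDerivAt (heatCDF r) (heatKernel r z) z := by
  rw [heatKernel_eq_scale hr]
  have := (hasDerivAt_cdf_gaussian (z / Real.sqrt r)).comp z ((hasDerivAt_id z).div_const _)
  simpa [heatCDF, Function.comp_def, div_eq_mul_inv] using! this

/-- This is the heat equation `∂_r = ½ ∂_z²`, integrated once in space. -/
lemma hasDerivAt_heatCDF_fst {r : ℝ} (hr : 0 < r) (z : ℝ) :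
    HasDerivAt (fun r => heatCDF r z) (heatKernelDeriv r z / 2) r := by
  have hs : 0 < Real.sqrt r := Real.sqrt_pos.2 hr
  have h1 : HasDerivAt (fun r => z / Real.sqrt r) (-(z / r) / 2 / Real.sqrt r) r := by
    have := ((Real.hasDerivAt_sqrt hr.ne').inv hs.ne').const_mul z
    refine HasDerivAt.congr_deriv this ?_
    rw [Real.sq_sqrt hr.le]; field_simp
  have := (hasDerivAt_cdf_gaussian (z / Real.sqrt r)).comp r h1
  refine HasDerivAt.congr_deriv this ?_
  rw [heatKernelDeriv, heatKernel_eq_scale hr]; ring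

lemma tendsto_heatCDF_atTop {r : ℝ} (hr : 0 < r) : Tendsto (heatCDF r) atTop (𝓝 1) :=
  (tendsto_cdf_atTop _).comp (tendsto_id.atTop_div_const (Real.sqrt_pos.2 hr))

lemma tendsto_heatCDF_atBot {r : ℝ} (hr : 0 < r) : Tendsto (heatCDF r) atBot (𝓝 0) :=
  (tendsto_cdf_atBot _).comp (tendsto_id.atBot_div_const (Real.sqrt_pos.2 hr))

lemma lintegral_heatKernel {r : ℝ} (hr : 0 < r) :
    ∫⁻ z, ENNReal.ofReal (heatKernel r z) = 1 := by
  simp_rw [heatKernel_eq_gaussianPDFReal hr]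
  exact lintegral_gaussianPDFReal_eq_one 0 (by simpa using hr)

/-! ### The heat flow on the line and its monotone rearrangement -/

section

/-- The density at time `r` of the heat flow started from the measure `ν` on the line. -/
def heatDensity (ν : Measure ℝ) (r x : ℝ) : ℝ := ∫ ξ, heatKernel r (x - ξ) ∂ν

/-- The space derivative of `heatDensity`. -/
def heatDensityDeriv (ν : Measure ℝ) (r x : ℝ) : ℝ := ∫ ξ, heatKernelDeriv r (x - ξ) ∂ν

/-- The distribution function at time `r` of the heat flow started from `ν`. -/
def heatFlowCDF (ν : Measure ℝ) (r x : ℝ) : ℝ := ∫ ξ, heatCDF r (x - ξ) ∂ν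

/-- The monotone rearrangement from time `s` to time `r` of the heat flow started from `ν`. -/
def heatTransport (ν : Measure ℝ) (s r y : ℝ) : ℝ :=
  Function.invFun (heatFlowCDF ν r) (heatFlowCDF ν s y)



lemma heatDensity_nonneg (ν : Measure ℝ) (r x : ℝ) : 0 ≤ heatDensity ν r x :=
  integral_nonneg fun _ => heatKernel_nonneg _ _

variable {ν : Measure ℝ} [IsFiniteMeasure ν]

lemma integrable_heatKernel_sub {r : ℝ} (hr : 0 < r) (x : ℝ) :
    Integrable (fun ξ => heatKernel r (x - ξ)) ν := by
  refine Integrable.of_bound (C := (Real.sqrt r)⁻¹) ?_ (ae_of_all _ fun ξ => ?_)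
  · exact (measurable_heatKernel.comp (f := fun ξ => (r, x - ξ)) (by fun_prop)).aestronglyMeasurable
  · rw [Real.norm_eq_abs, abs_of_nonneg (heatKernel_nonneg _ _)]
    exact heatKernel_le hr le_rfl _

lemma integrable_heatCDF_sub (r x : ℝ) : Integrable (fun ξ => heatCDF r (x - ξ)) ν := by
  refine Integrable.of_bound (C := 1) ?_ (ae_of_all _ fun ξ => ?_)
  · exact (measurable_heatCDF.comp (f := fun ξ => (r, x - ξ)) (by fun_prop)).aestronglyMeasurable
  · rw [Real.norm_eq_abs, abs_of_nonneg (heatCDF_nonneg _ _)]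
    exact heatCDF_le_one _ _

lemma heatDensity_pos (hν : ν ≠ 0) {r : ℝ} (hr : 0 < r) (x : ℝ) : 0 < heatDensity ν r x := by
  rw [heatDensity, integral_pos_iff_support_of_nonneg (fun _ => heatKernel_nonneg _ _)
    (integrable_heatKernel_sub hr x)]
  have : (Function.support fun ξ => heatKernel r (x - ξ)) = Set.univ := by
    ext ξ; simpa using (heatKernel_pos hr _).ne'
  rw [this]
  exact (Measure.measure_univ_pos).2 hν

lemma hasDerivAt_heatFlowCDF_snd {r : ℝ} (hr : 0 < r) (x : ℝ) :
    HasDerivAt (heatFlowCDF ν r) (heatDensity ν r x) x := by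
  refine (hasDerivAt_integral_of_dominated_loc_of_deriv_le (s := Set.univ)
    (bound := fun _ => (Real.sqrt r)⁻¹) (F := fun x ξ => heatCDF r (x - ξ))
    (F' := fun x ξ => heatKernel r (x - ξ)) univ_mem
    (Eventually.of_forall fun x => (integrable_heatCDF_sub r x).aestronglyMeasurable)
    (integrable_heatCDF_sub r x) (integrable_heatKernel_sub hr x).aestronglyMeasurable
    (ae_of_all _ fun ξ x _ => ?_) (integrable_const _) (ae_of_all _ fun ξ x _ => ?_)).2
  · rw [Real.norm_eq_abs, abs_of_nonneg (heatKernel_nonneg _ _)]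
    exact heatKernel_le hr le_rfl _
  · simpa using! (hasDerivAt_heatCDF_snd hr (x - ξ)).comp x ((hasDerivAt_id x).sub_const ξ)

lemma hasDerivAt_heatFlowCDF_fst {r : ℝ} (hr : 0 < r) (x : ℝ) :
    HasDerivAt (fun r => heatFlowCDF ν r x) (heatDensityDeriv ν r x / 2) r := by
  have hm : Measurable fun ξ => heatKernelDeriv r (x - ξ) / 2 :=
    (measurable_heatKernelDeriv.comp (f := fun ξ => (r, x - ξ)) (by fun_prop)).div_const 2
  -- The kernel is singular at time zero, so times are kept above `r / 2`, where the derivative has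
  -- a constant bound.
  have := (hasDerivAt_integral_of_dominated_loc_of_deriv_le (s := Set.Ioi (r / 2)) (μ := ν)
    (bound := fun _ => (r / 2)⁻¹) (F := fun r ξ => heatCDF r (x - ξ))
    (F' := fun r ξ => heatKernelDeriv r (x - ξ) / 2) (Ioi_mem_nhds (by linarith))
    (Eventually.of_forall fun r => (integrable_heatCDF_sub r x).aestronglyMeasurable)
    (integrable_heatCDF_sub r x) hm.aestronglyMeasurable
    (ae_of_all _ fun ξ t ht => ?_) (integrable_const _) (ae_of_all _ fun ξ t ht => ?_)).2
  · rwa [integral_div] at this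
  · have h := abs_heatKernelDeriv_le (half_pos hr) (le_of_lt ht) (x - ξ)
    rw [Real.norm_eq_abs, abs_div, abs_two]
    linarith [abs_nonneg (heatKernelDeriv t (x - ξ))]
  · exact hasDerivAt_heatCDF_fst ((half_pos hr).trans ht) _

lemma continuousAt_heatDensity {q : ℝ × ℝ} (hq : 0 < q.1) :
    ContinuousAt (fun q : ℝ × ℝ => heatDensity ν q.1 q.2) q := by
  have hn : ∀ᶠ p : ℝ × ℝ in 𝓝 q, q.1 / 2 < p.1 :=
    continuousAt_fst.eventually (lt_mem_nhds (half_lt_self hq))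
  refine continuousAt_of_dominated (F := fun (p : ℝ × ℝ) ξ => heatKernel p.1 (p.2 - ξ))
    (bound := fun _ => (Real.sqrt (q.1 / 2))⁻¹)
    (Eventually.of_forall fun p => ?_) ?_ (integrable_const _) (ae_of_all _ fun ξ => ?_)
  · exact (measurable_heatKernel.comp (f := fun ξ => (p.1, p.2 - ξ))
      (by fun_prop)).aestronglyMeasurable
  · filter_upwards [hn] with p hp
    refine ae_of_all _ fun ξ => ?_
    rw [Real.norm_eq_abs, abs_of_nonneg (heatKernel_nonneg _ _)]
    exact heatKernel_le (half_pos hq) hp.le _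
  · exact ContinuousAt.comp (f := fun p : ℝ × ℝ => (p.1, p.2 - ξ)) (x := q)
      (continuousAt_heatKernel (q := (q.1, q.2 - ξ)) hq) (by fun_prop)

lemma continuousAt_heatDensityDeriv {q : ℝ × ℝ} (hq : 0 < q.1) :
    ContinuousAt (fun q : ℝ × ℝ => heatDensityDeriv ν q.1 q.2) q := by
  have hn : ∀ᶠ p : ℝ × ℝ in 𝓝 q, q.1 / 2 < p.1 :=
    continuousAt_fst.eventually (lt_mem_nhds (half_lt_self hq))
  refine continuousAt_of_dominated (F := fun (p : ℝ × ℝ) ξ => heatKernelDeriv p.1 (p.2 - ξ))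
    (bound := fun _ => (q.1 / 2)⁻¹)
    (Eventually.of_forall fun p => ?_) ?_ (integrable_const _) (ae_of_all _ fun ξ => ?_)
  · exact (measurable_heatKernelDeriv.comp (f := fun ξ => (p.1, p.2 - ξ))
      (by fun_prop)).aestronglyMeasurable
  · filter_upwards [hn] with p hp
    exact ae_of_all _ fun ξ => abs_heatKernelDeriv_le (half_pos hq) hp.le _
  · exact ContinuousAt.comp (f := fun p : ℝ × ℝ => (p.1, p.2 - ξ)) (x := q)
      (continuousAt_heatKernelDeriv (q := (q.1, q.2 - ξ)) hq) (by fun_prop)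

lemma continuous_heatDensity {r : ℝ} (hr : 0 < r) : Continuous (heatDensity ν r) :=
  continuous_iff_continuousAt.2 fun x => ContinuousAt.comp (f := fun x : ℝ => (r, x)) (x := x)
    (continuousAt_heatDensity (ν := ν) (q := (r, x)) hr) (by fun_prop)

lemma continuous_heatFlowCDF {r : ℝ} (hr : 0 < r) : Continuous (heatFlowCDF ν r) :=
  continuous_iff_continuousAt.2 fun x => (hasDerivAt_heatFlowCDF_snd hr x).continuousAt

lemma strictMono_heatFlowCDF (hν : ν ≠ 0) {r : ℝ} (hr : 0 < r) :
    StrictMono (heatFlowCDF ν r) :=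
  strictMono_of_hasDerivAt_pos (fun x => hasDerivAt_heatFlowCDF_snd hr x)
    fun x => heatDensity_pos hν hr x

lemma tendsto_heatFlowCDF {r l : ℝ} {𝓕 : Filter ℝ} [𝓕.IsCountablyGenerated]
    (h : ∀ ξ : ℝ, Tendsto (fun x => heatCDF r (x - ξ)) 𝓕 (𝓝 l)) :
    Tendsto (heatFlowCDF ν r) 𝓕 (𝓝 (∫ _, l ∂ν)) :=
  tendsto_integral_filter_of_dominated_convergence (fun _ => 1)
    (Eventually.of_forall fun x => (integrable_heatCDF_sub r x).aestronglyMeasurable)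
    (Eventually.of_forall fun x => ae_of_all _ fun ξ => by
      rw [Real.norm_eq_abs, abs_of_nonneg (heatCDF_nonneg _ _)]
      exact heatCDF_le_one _ _)
    (integrable_const _) (ae_of_all _ h)

lemma tendsto_heatFlowCDF_atTop {r : ℝ} (hr : 0 < r) :
    Tendsto (heatFlowCDF ν r) atTop (𝓝 (∫ _, 1 ∂ν)) :=
  tendsto_heatFlowCDF fun ξ => (tendsto_heatCDF_atTop hr).comp
    (tendsto_atTop_add_const_right _ (-ξ) tendsto_id)

lemma tendsto_heatFlowCDF_atBot {r : ℝ} (hr : 0 < r) :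
    Tendsto (heatFlowCDF ν r) atBot (𝓝 (∫ _, 0 ∂ν)) :=
  tendsto_heatFlowCDF fun ξ => (tendsto_heatCDF_atBot hr).comp
    (tendsto_atBot_add_const_right _ (-ξ) tendsto_id)

/-- At every positive time the distribution function increases strictly from `0` to the total mass
of `ν`, so its values at time `s` lie strictly between limits that do not depend on time. The
intermediate value theorem then applies at time `r`, and `Function.invFun` never takes its default
value. -/
lemma exists_heatFlowCDF_eq (hν : ν ≠ 0) {s r : ℝ} (hs : 0 < s) (hr : 0 < r) (y : ℝ) :
    ∃ x, heatFlowCDF ν r x = heatFlowCDF ν s y := by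
  have hmono := strictMono_heatFlowCDF hν hs
  have h0 : (∫ _, 0 ∂ν : ℝ) < heatFlowCDF ν s y :=
    (hmono.monotone.le_of_tendsto (tendsto_heatFlowCDF_atBot hs) (y - 1)).trans_lt
      (hmono (by linarith))
  have h1 : heatFlowCDF ν s y < (∫ _, 1 ∂ν : ℝ) :=
    (hmono (by linarith)).trans_le
      (hmono.monotone.ge_of_tendsto (tendsto_heatFlowCDF_atTop hs) (y + 1))
  obtain ⟨a, ha⟩ := ((tendsto_heatFlowCDF_atBot hr).eventually (gt_mem_nhds h0)).exists
  obtain ⟨b, hb⟩ := ((tendsto_heatFlowCDF_atTop hr).eventually (lt_mem_nhds h1)).exists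
  exact mem_range_of_exists_le_of_exists_ge (continuous_heatFlowCDF hr) ⟨a, ha.le⟩ ⟨b, hb.le⟩

lemma heatFlowCDF_heatTransport (hν : ν ≠ 0) {s r : ℝ} (hs : 0 < s) (hr : 0 < r) (y : ℝ) :
    heatFlowCDF ν r (heatTransport ν s r y) = heatFlowCDF ν s y :=
  Function.invFun_eq (exists_heatFlowCDF_eq hν hs hr y)

lemma heatTransport_eq_iff (hν : ν ≠ 0) {s r : ℝ} (hs : 0 < s) (hr : 0 < r) {y x : ℝ} :
    heatTransport ν s r y = x ↔ heatFlowCDF ν r x = heatFlowCDF ν s y := by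
  rw [← heatFlowCDF_heatTransport hν hs hr y, (strictMono_heatFlowCDF hν hr).injective.eq_iff]
  exact eq_comm

lemma heatTransport_le_iff (hν : ν ≠ 0) {s r : ℝ} (hs : 0 < s) (hr : 0 < r) {y x : ℝ} :
    heatTransport ν s r y ≤ x ↔ heatFlowCDF ν s y ≤ heatFlowCDF ν r x := by
  rw [← heatFlowCDF_heatTransport hν hs hr y, (strictMono_heatFlowCDF hν hr).le_iff_le]

lemma heatTransport_self (hν : ν ≠ 0) {s : ℝ} (hs : 0 < s) (y : ℝ) :
    heatTransport ν s s y = y :=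
  (heatTransport_eq_iff hν hs hs).2 rfl

lemma monotone_heatTransport (hν : ν ≠ 0) {s r : ℝ} (hs : 0 < s) (hr : 0 < r) :
    Monotone (heatTransport ν s r) := fun y z h => by
  rw [heatTransport_le_iff hν hs hr, heatFlowCDF_heatTransport hν hs hr]
  exact (strictMono_heatFlowCDF hν hs).monotone h

/-- The monotone rearrangement along the heat flow moves with velocity `-½ (log p_r)'`. -/
lemma hasDerivAt_heatTransport (hν : ν ≠ 0) {s r : ℝ} (hs : 0 < s) (hr : 0 < r) (y : ℝ) :
    HasDerivAt (fun r => heatTransport ν s r y)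
      (-(heatDensityDeriv ν r (heatTransport ν s r y) /
        (2 * heatDensity ν r (heatTransport ν s r y)))) r := by
  set x := heatTransport ν s r y with hx
  have hpos : ∀ᶠ v : ℝ × ℝ in 𝓝 (r, x), 0 < v.1 :=
    continuousAt_fst.eventually (lt_mem_nhds hr)
  have d₁ : ∀ᶠ v : ℝ × ℝ in 𝓝 (r, x), HasFDerivAt (fun a => heatFlowCDF ν a v.2)
      (ContinuousLinearMap.toSpanSingleton ℝ (heatDensityDeriv ν v.1 v.2 / 2)) v.1 := by
    filter_upwards [hpos] with v hv using (hasDerivAt_heatFlowCDF_fst hv v.2).hasFDerivAt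
  have d₂ : ∀ᶠ v : ℝ × ℝ in 𝓝 (r, x), HasFDerivAt (fun a => heatFlowCDF ν v.1 a)
      (ContinuousLinearMap.toSpanSingleton ℝ (heatDensity ν v.1 v.2)) v.2 := by
    filter_upwards [hpos] with v hv using (hasDerivAt_heatFlowCDF_snd hv v.2).hasFDerivAt
  have hlin : Continuous fun c : ℝ => (ContinuousLinearMap.toSpanSingleton ℝ c : ℝ →L[ℝ] ℝ) :=
    (ContinuousLinearMap.toSpanSingletonLE ℝ ℝ ℝ).toLinearMap.continuous_of_finiteDimensional
  have c₁ : ContinuousAt ↿(fun a b => (ContinuousLinearMap.toSpanSingleton ℝ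
      (heatDensityDeriv ν a b / 2) : ℝ →L[ℝ] ℝ)) (r, x) :=
    hlin.continuousAt.comp ((continuousAt_heatDensityDeriv (ν := ν) (q := (r, x)) hr).div_const 2)
  have c₂ : ContinuousAt ↿(fun a b => (ContinuousLinearMap.toSpanSingleton ℝ
      (heatDensity ν a b) : ℝ →L[ℝ] ℝ)) (r, x) :=
    hlin.continuousAt.comp (continuousAt_heatDensity (ν := ν) (q := (r, x)) hr)
  have hP : heatDensity ν r x ≠ 0 := (heatDensity_pos hν hr x).ne'
  let e : ℝ ≃L[ℝ] ℝ := ContinuousLinearEquiv.smulLeft (Units.mk0 _ hP)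
  have he : (e : ℝ →L[ℝ] ℝ) = ContinuousLinearMap.toSpanSingleton ℝ (heatDensity ν r x) := by
    ext; simp [e]
  have hinv : (ContinuousLinearMap.toSpanSingleton ℝ (heatDensity ν r x) : ℝ →L[ℝ] ℝ).IsInvertible :=
    ⟨e, he⟩
  -- The trajectory is a level curve of the distribution function `F` in `(r, x)`, so its slope is
  -- `-∂_r F / ∂_x F`, with `∂_r F = p' / 2` and `∂_x F = p`.
  have key := hasStrictFDerivAt_implicitFunctionOfBivariate d₁ d₂ c₁ c₂ hinv
  have hev := eventually_apply_implicitFunctionOfBivariate d₁ d₂ c₁ c₂ hinv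
  -- Strict monotonicity in space leaves only one point on the level set at each time, which
  -- identifies the implicit function with the transport.
  have heq : (fun r => heatTransport ν s r y) =ᶠ[𝓝 r]
      implicitFunctionOfBivariate d₁ d₂ c₁ c₂ hinv := by
    filter_upwards [hev, lt_mem_nhds hr] with a ha ha0
    rw [heatTransport_eq_iff hν hs ha0, ha]
    exact heatFlowCDF_heatTransport hν hs hr y
  refine (key.hasFDerivAt.hasDerivAt.congr_of_eventuallyEq heq).congr_deriv ?_
  simp only [← he]
  rw [ContinuousLinearMap.inverse_equiv]
  simp only [ContinuousLinearMap.comp_apply, neg_apply,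
    ContinuousLinearMap.toSpanSingleton_apply, one_smul, neg_inj, ContinuousLinearEquiv.coe_coe]
  rw [ContinuousLinearEquiv.symm_apply_eq]
  change _ = heatDensity ν r x * _
  field_simp

end

/-! ### The cost of the monotone rearrangement -/

section

/-- The Cauchy–Schwarz inequality with a weight. -/
lemma sq_integral_mul_le {α : Type*} {m : MeasurableSpace α} {μ : Measure α} {f w : α → ℝ}
    (hw : ∀ a, 0 ≤ w a) (iw : Integrable w μ) (ifw : Integrable (fun a => f a * w a) μ)
    (iffw : Integrable (fun a => f a ^ 2 * w a) μ) :
    (∫ a, f a * w a ∂μ) ^ 2 ≤ (∫ a, w a ∂μ) * ∫ a, f a ^ 2 * w a ∂μ := by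
  rcases (integral_nonneg hw : 0 ≤ ∫ a, w a ∂μ).eq_or_lt with h0 | h0
  · have hae := (integral_eq_zero_iff_of_nonneg hw iw).1 h0.symm
    have : ∫ a, f a * w a ∂μ = 0 := by
      rw [← integral_zero α ℝ (μ := μ)]
      refine integral_congr_ae (hae.mono fun a ha => ?_)
      simp [show w a = 0 from ha]
    rw [this, ← h0]; simp
  -- `c` is the weighted mean of `f`; the inequality is `0 ≤ ∫ (f - c)² w`, expanded.
  · obtain ⟨c, hc⟩ : ∃ c, c = (∫ a, f a * w a ∂μ) / ∫ a, w a ∂μ := ⟨_, rfl⟩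
    have h1 : 0 ≤ ∫ a, (f a ^ 2 * w a - 2 * c * (f a * w a) + c ^ 2 * w a) ∂μ := by
      refine integral_nonneg fun a => ?_
      have : f a ^ 2 * w a - 2 * c * (f a * w a) + c ^ 2 * w a = (f a - c) ^ 2 * w a := by ring
      simp only [Pi.zero_apply, this]
      exact mul_nonneg (sq_nonneg _) (hw a)
    have i1 : Integrable (fun a => 2 * c * (f a * w a)) μ := ifw.const_mul _
    have i2 : Integrable (fun a => f a ^ 2 * w a - 2 * c * (f a * w a)) μ := iffw.sub i1
    rw [integral_add i2 (iw.const_mul _), integral_sub iffw i1, integral_const_mul,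
      integral_const_mul] at h1
    rw [eq_div_iff h0.ne'] at hc
    rw [← hc] at h1 ⊢
    nlinarith

lemma sq_intervalIntegral_le {f : ℝ → ℝ} {a b : ℝ} (hab : a ≤ b)
    (hf : ContinuousOn f (Set.uIcc a b)) :
    (∫ x in a..b, f x) ^ 2 ≤ (b - a) * ∫ x in a..b, f x ^ 2 := by
  have h1 : Integrable f (volume.restrict (Set.Ioc a b)) := hf.intervalIntegrable.1
  have h2 : Integrable (fun x => f x ^ 2) (volume.restrict (Set.Ioc a b)) :=
    (hf.pow 2).intervalIntegrable.1
  have := sq_integral_mul_le (μ := volume.restrict (Set.Ioc a b)) (f := f) (w := fun _ => 1)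
    (fun _ => zero_le_one) (integrable_const _) (by simpa using h1) (by simpa using h2)
  simp only [mul_one] at this
  rw [intervalIntegral.integral_of_le hab, intervalIntegral.integral_of_le hab]
  refine this.trans_eq ?_
  simp [hab]

section

variable (ν : Measure ℝ) [IsFiniteMeasure ν]

lemma measurable_heatDensity : Measurable fun q : ℝ × ℝ => heatDensity ν q.1 q.2 :=
  (StronglyMeasurable.integral_prod_right (f := fun (q : ℝ × ℝ) ξ => heatKernel q.1 (q.2 - ξ))
    (measurable_heatKernel.comp (f := fun p : (ℝ × ℝ) × ℝ => (p.1.1, p.1.2 - p.2))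
      (by fun_prop)).stronglyMeasurable).measurable

lemma measurable_heatDensityDeriv : Measurable fun q : ℝ × ℝ => heatDensityDeriv ν q.1 q.2 :=
  (StronglyMeasurable.integral_prod_right
    (f := fun (q : ℝ × ℝ) ξ => heatKernelDeriv q.1 (q.2 - ξ))
    (measurable_heatKernelDeriv.comp (f := fun p : (ℝ × ℝ) × ℝ => (p.1.1, p.1.2 - p.2))
      (by fun_prop)).stronglyMeasurable).measurable

lemma measurable_heatFlowCDF : Measurable fun q : ℝ × ℝ => heatFlowCDF ν q.1 q.2 :=
  (StronglyMeasurable.integral_prod_right (f := fun (q : ℝ × ℝ) ξ => heatCDF q.1 (q.2 - ξ))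
    (measurable_heatCDF.comp (f := fun p : (ℝ × ℝ) × ℝ => (p.1.1, p.1.2 - p.2))
      (by fun_prop)).stronglyMeasurable).measurable

end

variable {ν : Measure ℝ} [IsFiniteMeasure ν]

/-- Replacing the time by `max q.1 s` keeps it positive on the whole plane, so joint measurability
holds without restriction; only times after `s` are used later, where nothing changes. -/
lemma measurable_heatTransport_max (hν : ν ≠ 0) {s : ℝ} (hs : 0 < s) :
    Measurable fun q : ℝ × ℝ => heatTransport ν s (max q.1 s) q.2 := by
  refine measurable_of_Iic fun a => ?_
  have : (fun q : ℝ × ℝ => heatTransport ν s (max q.1 s) q.2) ⁻¹' Set.Iic a =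
      {q : ℝ × ℝ | heatFlowCDF ν s q.2 ≤ heatFlowCDF ν (max q.1 s) a} := by
    ext q
    exact heatTransport_le_iff hν hs (hs.trans_le (le_max_right _ _))
  rw [this]
  exact measurableSet_le
    ((measurable_heatFlowCDF ν).comp (f := fun q : ℝ × ℝ => (s, q.2)) (by fun_prop))
    ((measurable_heatFlowCDF ν).comp (f := fun q : ℝ × ℝ => (max q.1 s, a)) (by fun_prop))

lemma lintegral_Ioc_heatDensity {r a b : ℝ} (hr : 0 < r) (hab : a ≤ b) :
    ∫⁻ x in Set.Ioc a b, ENNReal.ofReal (heatDensity ν r x) =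
      ENNReal.ofReal (heatFlowCDF ν r b - heatFlowCDF ν r a) := by
  have hi := (continuous_heatDensity (ν := ν) hr).intervalIntegrable (μ := volume) a b
  rw [← ofReal_integral_eq_lintegral_ofReal hi.1 (ae_of_all _ fun x => heatDensity_nonneg ν r x),
    ← intervalIntegral.integral_of_le hab,
    intervalIntegral.integral_eq_sub_of_hasDerivAt
      (fun x _ => hasDerivAt_heatFlowCDF_snd hr x) hi]

lemma map_heatTransport (hν : ν ≠ 0) {s r : ℝ} (hs : 0 < s) (hr : 0 < r) :
    (volume.withDensity fun y => ENNReal.ofReal (heatDensity ν s y)).map (heatTransport ν s r) =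
      volume.withDensity fun x => ENNReal.ofReal (heatDensity ν r x) := by
  -- `Measure.ext_of_Ioc` wants local finiteness of the measure on the left, which is immediate for
  -- a continuous density.
  symm
  have := IsLocallyFiniteMeasure.withDensity_ofReal (μ := (volume : Measure ℝ))
    (continuous_heatDensity (ν := ν) hr)
  refine Measure.ext_of_Ioc _ _ fun a b hab => ?_
  rw [Measure.map_apply (monotone_heatTransport hν hs hr).measurable measurableSet_Ioc]
  have hpre : heatTransport ν s r ⁻¹' Set.Ioc a b =
      Set.Ioc (heatTransport ν r s a) (heatTransport ν r s b) := by
    -- The transports from `s` to `r` and from `r` to `s` are adjoint for the order, hence preimages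
    -- of half-open intervals are half-open intervals.
    have key : ∀ y c, heatTransport ν s r y ≤ c ↔ y ≤ heatTransport ν r s c := fun y c => by
      rw [heatTransport_le_iff hν hs hr, ← heatFlowCDF_heatTransport hν hr hs,
        (strictMono_heatFlowCDF hν hs).le_iff_le]
    ext y
    simp only [Set.mem_preimage, Set.mem_Ioc, key, ← not_le]
  rw [hpre, withDensity_apply _ measurableSet_Ioc, withDensity_apply _ measurableSet_Ioc,
    lintegral_Ioc_heatDensity hr hab.le,
    lintegral_Ioc_heatDensity hs (monotone_heatTransport hν hr hs hab.le),
    heatFlowCDF_heatTransport hν hr hs, heatFlowCDF_heatTransport hν hr hs]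

lemma lintegral_comp_heatTransport (hν : ν ≠ 0) {s r : ℝ} (hs : 0 < s) (hr : 0 < r)
    {f : ℝ → ℝ≥0∞} (hf : Measurable f) :
    ∫⁻ y, f (heatTransport ν s r y) * ENNReal.ofReal (heatDensity ν s y) =
      ∫⁻ x, f x * ENNReal.ofReal (heatDensity ν r x) := by
  have h := congrArg (fun m => ∫⁻ x, f x ∂m) (map_heatTransport hν hs hr)
  have hT := (monotone_heatTransport hν hs hr).measurable
  have hfT : Measurable fun y => f (heatTransport ν s r y) := hf.comp hT
  rw [lintegral_map hf hT,
    lintegral_withDensity_eq_lintegral_mul _ (continuous_heatDensity hs).measurable.ennreal_ofReal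
      hfT,
    lintegral_withDensity_eq_lintegral_mul _ (continuous_heatDensity hr).measurable.ennreal_ofReal
      hf] at h
  simpa [mul_comm] using! h

/-- The displacement is the time integral of the velocity `-v / 2`. Cauchy–Schwarz in time produces
the factor `t - s`, and the square of `½` the factor `1 / 4`. -/
lemma sq_heatTransport_sub_le (hν : ν ≠ 0) {s t : ℝ} (hs : 0 < s) (hst : s ≤ t) (y : ℝ) :
    ENNReal.ofReal ((heatTransport ν s t y - y) ^ 2) ≤ ENNReal.ofReal ((t - s) / 4) *
      ∫⁻ r in Set.Ioc s t, ENNReal.ofReal ((heatDensityDeriv ν r (heatTransport ν s r y) /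
        heatDensity ν r (heatTransport ν s r y)) ^ 2) := by
  set v : ℝ → ℝ := fun r => heatDensityDeriv ν r (heatTransport ν s r y) /
        heatDensity ν r (heatTransport ν s r y) with hv
  have hpos : ∀ r ∈ Set.uIcc s t, 0 < r := fun r hr => by
    rw [Set.uIcc_of_le hst] at hr; exact hs.trans_le hr.1
  have hd : ∀ r ∈ Set.uIcc s t, HasDerivAt (fun r => heatTransport ν s r y) (-(v r / 2)) r := by
    intro r hr
    refine (hasDerivAt_heatTransport hν hs (hpos r hr) y).congr_deriv ?_
    simp only [hv]; ring
  have hcv : ContinuousOn v (Set.uIcc s t) := by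
    intro r hr
    have hp : ContinuousAt (fun r => (r, heatTransport ν s r y)) r :=
      continuousAt_id.prodMk (hd r hr).continuousAt
    refine ContinuousAt.continuousWithinAt (ContinuousAt.div ?_ ?_ ?_)
    · exact ContinuousAt.comp (f := fun r => (r, heatTransport ν s r y)) (x := r)
        (continuousAt_heatDensityDeriv (ν := ν) (q := (r, heatTransport ν s r y)) (hpos r hr)) hp
    · exact ContinuousAt.comp (f := fun r => (r, heatTransport ν s r y)) (x := r)
        (continuousAt_heatDensity (ν := ν) (q := (r, heatTransport ν s r y)) (hpos r hr)) hp
    · exact (heatDensity_pos hν (hpos r hr) _).ne'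
  have hftc := intervalIntegral.integral_eq_sub_of_hasDerivAt hd
    (hcv.div_const 2).neg.intervalIntegrable
  rw [heatTransport_self hν hs] at hftc
  have hcs := sq_intervalIntegral_le hst hcv
  have h1 : (heatTransport ν s t y - y) ^ 2 ≤ (t - s) / 4 * ∫ r in s..t, v r ^ 2 := by
    rw [← hftc, intervalIntegral.integral_neg, intervalIntegral.integral_div]
    nlinarith
  refine (ENNReal.ofReal_le_ofReal h1).trans_eq ?_
  have hi : Integrable (fun r => v r ^ 2) (volume.restrict (Set.Ioc s t)) :=
    (hcv.pow 2).intervalIntegrable.1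
  rw [ENNReal.ofReal_mul (by linarith), intervalIntegral.integral_of_le hst,
    ofReal_integral_eq_lintegral_ofReal hi (ae_of_all _ fun r => sq_nonneg _)]

/-- The cost of the monotone rearrangement along the heat flow is at most a quarter of the elapsed
time, times the Fisher information integrated over time. -/
lemma lintegral_sq_heatTransport_sub_le (hν : ν ≠ 0) {s t : ℝ} (hs : 0 < s) (hst : s ≤ t) :
    ∫⁻ y, ENNReal.ofReal ((heatTransport ν s t y - y) ^ 2) * ENNReal.ofReal (heatDensity ν s y) ≤
      ENNReal.ofReal ((t - s) / 4) * ∫⁻ x, ∫⁻ r in Set.Ioc s t,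
        ENNReal.ofReal (heatDensityDeriv ν r x ^ 2 / heatDensity ν r x) := by
  set G : ℝ → ℝ → ℝ≥0∞ := fun r x =>
    ENNReal.ofReal ((heatDensityDeriv ν r x / heatDensity ν r x) ^ 2) with hG
  have mG : Measurable fun q : ℝ × ℝ => G q.1 q.2 :=
    (((measurable_heatDensityDeriv ν).div (measurable_heatDensity ν)).pow_const 2).ennreal_ofReal
  have mP : ∀ r, Measurable fun y => ENNReal.ofReal (heatDensity ν r y) := fun r =>
    ((measurable_heatDensity ν).comp (f := fun y : ℝ => (r, y)) (by fun_prop)).ennreal_ofReal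
  have mT := measurable_heatTransport_max hν hs
  have mGT : Measurable fun q : ℝ × ℝ => G q.1 (heatTransport ν s (max q.1 s) q.2) :=
    mG.comp (f := fun q : ℝ × ℝ => (q.1, heatTransport ν s (max q.1 s) q.2)) (by fun_prop)
  have hmax : ∀ y, ∫⁻ r in Set.Ioc s t, G r (heatTransport ν s r y) =
      ∫⁻ r in Set.Ioc s t, G r (heatTransport ν s (max r s) y) := fun y =>
    setLIntegral_congr_fun measurableSet_Ioc fun r hr => by simp only [max_eq_left hr.1.le]
  calc _ ≤ ∫⁻ y, ENNReal.ofReal ((t - s) / 4) *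
        ∫⁻ r in Set.Ioc s t, G r (heatTransport ν s (max r s) y) *
          ENNReal.ofReal (heatDensity ν s y) := by
        refine lintegral_mono fun y => ?_
        have mGy : Measurable fun r => G r (heatTransport ν s (max r s) y) :=
          mGT.comp (f := fun r : ℝ => (r, y)) (by fun_prop)
        rw [lintegral_mul_const _ mGy, ← mul_assoc, ← hmax]
        gcongr
        exact sq_heatTransport_sub_le hν hs hst y
    _ = ENNReal.ofReal ((t - s) / 4) * ∫⁻ r in Set.Ioc s t, ∫⁻ y,
          G r (heatTransport ν s (max r s) y) * ENNReal.ofReal (heatDensity ν s y) := by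
        rw [lintegral_const_mul, lintegral_lintegral_swap]
        · refine Measurable.aemeasurable ?_
          exact (mGT.comp (f := fun q : ℝ × ℝ => (q.2, q.1)) (by fun_prop)).mul
            ((mP s).comp measurable_fst)
        · exact Measurable.lintegral_prod_right' (f := fun q : ℝ × ℝ =>
            G q.2 (heatTransport ν s (max q.2 s) q.1) * ENNReal.ofReal (heatDensity ν s q.1))
            ((mGT.comp (f := fun q : ℝ × ℝ => (q.2, q.1)) (by fun_prop)).mul
              ((mP s).comp measurable_fst))
    -- At each time `r` the rearrangement carries the density at time `s` to the density at time
    -- `r`; then `(p' / p)² p = p'² / p`.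
    _ = ENNReal.ofReal ((t - s) / 4) * ∫⁻ r in Set.Ioc s t, ∫⁻ x,
          ENNReal.ofReal (heatDensityDeriv ν r x ^ 2 / heatDensity ν r x) := by
        congr 1
        refine setLIntegral_congr_fun measurableSet_Ioc fun r hr => ?_
        have hr0 : 0 < r := hs.trans hr.1
        simp only [max_eq_left hr.1.le]
        rw [lintegral_comp_heatTransport hν hs hr0 (f := G r)
          (mG.comp (f := fun x : ℝ => (r, x)) (by fun_prop))]
        refine lintegral_congr fun x => ?_
        have := heatDensity_pos hν hr0 x
        simp only [hG]
        rw [← ENNReal.ofReal_mul (sq_nonneg _)]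
        congr 1
        field_simp
    _ = _ := by
        rw [lintegral_lintegral_swap]
        exact (((measurable_heatDensityDeriv ν).pow_const 2).div
          (measurable_heatDensity ν)).ennreal_ofReal.aemeasurable

end

/-! ### Gaussian noise in several coordinates and its one-dimensional slices -/

section

section

variable {ι : Type*}

lemma prod_heatKernel_le {D : ι → ℝ} (hD : ∀ j, 0 < D j) (z : ι → ℝ) (S : Finset ι) :
    ∏ j ∈ S, heatKernel (D j) (z j) ≤ ∏ j ∈ S, (Real.sqrt (D j))⁻¹ :=
  Finset.prod_le_prod (fun _ _ => heatKernel_nonneg _ _) fun j _ => heatKernel_le (hD j) le_rfl _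

lemma measurable_prod_heatKernel (S : Finset ι) :
    Measurable fun q : (ι → ℝ) × (ι → ℝ) => ∏ j ∈ S, heatKernel (q.1 j) (q.2 j) :=
  Finset.measurable_fun_prod _ fun j _ =>
    measurable_heatKernel.comp (f := fun q : (ι → ℝ) × (ι → ℝ) => (q.1 j, q.2 j)) (by fun_prop)

end

variable {ι : Type*} [Fintype ι]

/-- The density of the centred Gaussian law with independent coordinates of variances `D j`. -/
def prodKernel (D z : ι → ℝ) : ℝ := ∏ j, heatKernel (D j) (z j)

/-- The density of the convolution of `μ` with the Gaussian law of variances `D`. -/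
def noisyDensity (μ : Measure (ι → ℝ)) (D y : ι → ℝ) : ℝ := ∫ ξ, prodKernel D (y - ξ) ∂μ

/-- The law of the sum of a random vector of law `μ` and of an independent Gaussian vector with
independent coordinates of variances `D`. -/
def noisyLaw (μ : Measure (ι → ℝ)) (D : ι → ℝ) : Measure (ι → ℝ) :=
  volume.withDensity fun y => ENNReal.ofReal (noisyDensity μ D y)

lemma prodKernel_pos {D : ι → ℝ} (hD : ∀ j, 0 < D j) (z : ι → ℝ) : 0 < prodKernel D z :=
  Finset.prod_pos fun j _ => heatKernel_pos (hD j) _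

lemma prodKernel_nonneg (D z : ι → ℝ) : 0 ≤ prodKernel D z :=
  Finset.prod_nonneg fun _ _ => heatKernel_nonneg _ _

lemma measurable_prodKernel :
    Measurable fun q : (ι → ℝ) × (ι → ℝ) => prodKernel q.1 q.2 :=
  measurable_prod_heatKernel _

lemma lintegral_ofReal_prod {m : ι → Measure ℝ} [∀ i, SigmaFinite (m i)] {f : ι → ℝ → ℝ}
    (hf : ∀ i, Integrable (f i) (m i)) (h0 : ∀ i x, 0 ≤ f i x) :
    ∫⁻ x : ι → ℝ, ENNReal.ofReal (∏ i, f i (x i)) ∂(Measure.pi m) =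
      ∏ i, ∫⁻ x, ENNReal.ofReal (f i x) ∂(m i) := by
  have hi : Integrable (fun x : ι → ℝ => ∏ i, f i (x i)) (Measure.pi m) :=
    Integrable.fintype_prod_dep hf
  rw [← ofReal_integral_eq_lintegral_ofReal hi (ae_of_all
    _ fun x => Finset.prod_nonneg fun i _ => h0 i _),
    integral_fintype_prod_eq_prod, ENNReal.ofReal_prod_of_nonneg
      fun i _ => integral_nonneg (h0 i)]
  exact Finset.prod_congr rfl fun i _ =>
    ofReal_integral_eq_lintegral_ofReal (hf i) (ae_of_all _ (h0 i))

lemma lintegral_prodKernel_sub {D : ι → ℝ} (hD : ∀ j, 0 < D j) (ξ : ι → ℝ) :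
    ∫⁻ y, ENNReal.ofReal (prodKernel D (y - ξ)) = 1 := by
  rw [lintegral_sub_right_eq_self (fun y => ENNReal.ofReal (prodKernel D y)) ξ]
  unfold prodKernel
  rw [volume_pi, lintegral_ofReal_prod (f := fun j => heatKernel (D j))
    (fun j => integrable_heatKernel (hD j)) fun _ _ => heatKernel_nonneg _ _]
  simp [lintegral_heatKernel (hD _)]

section Slice

variable [DecidableEq ι]

/-- The partial derivative of `noisyDensity` in the direction of the coordinate `i`. -/
def noisyPartial (μ : Measure (ι → ℝ)) (D : ι → ℝ) (i : ι) (y : ι → ℝ) : ℝ :=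
  ∫ ξ, heatKernelDeriv (D i) (y i - ξ i) *
    ∏ j ∈ Finset.univ.erase i, heatKernel (D j) (y j - ξ j) ∂μ

/-- The law of the coordinate `i` of a vector of law `μ`, weighted by the likelihood of the
coordinates other than `i` of `y`, seen as noisy observations. -/
def sliceMeasure (μ : Measure (ι → ℝ)) (D : ι → ℝ) (i : ι) (y : ι → ℝ) : Measure ℝ :=
  (μ.withDensity fun ξ => ENNReal.ofReal
    (∏ j ∈ Finset.univ.erase i, heatKernel (D j) (y j - ξ j))).map fun ξ => ξ i

lemma measurable_sliceWeight (D : ι → ℝ) (i : ι) :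
    Measurable fun q : (ι → ℝ) × (ι → ℝ) =>
      ∏ j ∈ Finset.univ.erase i, heatKernel (D j) (q.1 j - q.2 j) :=
  (measurable_prod_heatKernel (Finset.univ.erase i)).comp
    (f := fun q : (ι → ℝ) × (ι → ℝ) => (D, q.1 - q.2)) (by fun_prop)

lemma measurable_sliceWeight_right (D : ι → ℝ) (i : ι) (y : ι → ℝ) :
    Measurable fun ξ : ι → ℝ => ∏ j ∈ Finset.univ.erase i, heatKernel (D j) (y j - ξ j) :=
  (measurable_sliceWeight D i).comp (f := fun ξ => (y, ξ)) (by fun_prop)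

lemma sliceWeight_nonneg (D : ι → ℝ) (i : ι) (y ξ : ι → ℝ) :
    0 ≤ ∏ j ∈ Finset.univ.erase i, heatKernel (D j) (y j - ξ j) :=
  Finset.prod_nonneg fun _ _ => heatKernel_nonneg _ _

/-- The weight omits the factor of index `i`. The slice is thus constant along lines parallel to
axis `i` and while the noise of coordinate `i` increases: a single initial measure serves the whole
one-dimensional heat flow. -/
lemma sliceMeasure_update (μ : Measure (ι → ℝ)) (D : ι → ℝ) (i : ι) (y : ι → ℝ) (r x : ℝ) :
    sliceMeasure μ (Function.update D i r) i (Function.update y i x) = sliceMeasure μ D i y := by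
  unfold sliceMeasure
  congr 2
  ext ξ
  congr 1
  refine Finset.prod_congr rfl fun j hj => ?_
  rw [Function.update_of_ne (Finset.ne_of_mem_erase hj),
    Function.update_of_ne (Finset.ne_of_mem_erase hj)]

lemma isFiniteMeasure_sliceMeasure (μ : Measure (ι → ℝ)) [IsFiniteMeasure μ] {D : ι → ℝ}
    (hD : ∀ j, 0 < D j) (i : ι) (y : ι → ℝ) : IsFiniteMeasure (sliceMeasure μ D i y) := by
  have : IsFiniteMeasure (μ.withDensity fun ξ => ENNReal.ofReal
      (∏ j ∈ Finset.univ.erase i, heatKernel (D j) (y j - ξ j))) := by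
    refine isFiniteMeasure_withDensity (ne_of_lt ?_)
    calc _ ≤ ∫⁻ _, ENNReal.ofReal (∏ j ∈ Finset.univ.erase i, (Real.sqrt (D j))⁻¹) ∂μ :=
          lintegral_mono fun ξ => ENNReal.ofReal_le_ofReal (prod_heatKernel_le hD (y - ξ) _)
      _ < ⊤ := by
          rw [lintegral_const]
          exact ENNReal.mul_lt_top ENNReal.ofReal_lt_top (measure_lt_top _ _)
  unfold sliceMeasure
  infer_instance

lemma sliceMeasure_ne_zero {μ : Measure (ι → ℝ)} (hμ : μ ≠ 0) {D : ι → ℝ}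
    (hD : ∀ j, 0 < D j) (i : ι) (y : ι → ℝ) : sliceMeasure μ D i y ≠ 0 := by
  unfold sliceMeasure
  rw [Ne, Measure.map_eq_zero_iff (measurable_pi_apply i).aemeasurable, withDensity_eq_zero_iff
    (measurable_sliceWeight_right D i y).ennreal_ofReal.aemeasurable]
  intro h
  apply hμ
  rw [← ae_eq_bot, ← empty_mem_iff_bot]
  filter_upwards [h] with ξ hξ
  have : 0 < ∏ j ∈ Finset.univ.erase i, heatKernel (D j) (y j - ξ j) :=
    Finset.prod_pos fun j _ => heatKernel_pos (hD j) _
  simp only [Pi.zero_apply, ENNReal.ofReal_eq_zero] at hξ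
  linarith

lemma integral_sliceMeasure (μ : Measure (ι → ℝ)) (D : ι → ℝ) (i : ι) (y : ι → ℝ)
    {f : ℝ → ℝ} (hf : Measurable f) :
    ∫ x, f x ∂(sliceMeasure μ D i y) =
      ∫ ξ, f (ξ i) * ∏ j ∈ Finset.univ.erase i, heatKernel (D j) (y j - ξ j) ∂μ := by
  unfold sliceMeasure
  rw [integral_map (measurable_pi_apply i).aemeasurable hf.aestronglyMeasurable,
    integral_withDensity_eq_integral_toReal_smul
      (measurable_sliceWeight_right D i y).ennreal_ofReal (ae_of_all _ fun _ => ENNReal.ofReal_lt_top)]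
  refine integral_congr_ae (ae_of_all _ fun ξ => ?_)
  simp only [smul_eq_mul]
  rw [ENNReal.toReal_ofReal (sliceWeight_nonneg _ _ _ _), mul_comm]

/-- Splitting the factor of index `i` off the product kernel shows that the noisy density,
restricted to a line parallel to axis `i`, is a heat flow on the line started from the slice. This
reduces the problem to dimension one. -/
lemma heatDensity_sliceMeasure (μ : Measure (ι → ℝ)) (D : ι → ℝ) (i : ι) (y : ι → ℝ) :
    heatDensity (sliceMeasure μ D i y) (D i) (y i) = noisyDensity μ D y := by
  unfold heatDensity
  have hm : Measurable fun ξ => heatKernel (D i) (y i - ξ) :=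
    measurable_heatKernel.comp (f := fun ξ : ℝ => (D i, y i - ξ)) (by fun_prop)
  rw [integral_sliceMeasure μ D i y hm]
  refine integral_congr_ae (ae_of_all _ fun ξ => ?_)
  exact Finset.mul_prod_erase Finset.univ (fun j => heatKernel (D j) (y j - ξ j))
    (Finset.mem_univ i)

lemma heatDensityDeriv_sliceMeasure (μ : Measure (ι → ℝ)) (D : ι → ℝ) (i : ι) (y : ι → ℝ) :
    heatDensityDeriv (sliceMeasure μ D i y) (D i) (y i) = noisyPartial μ D i y := by
  unfold heatDensityDeriv
  exact integral_sliceMeasure μ D i y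
    (measurable_heatKernelDeriv.comp (f := fun ξ : ℝ => (D i, y i - ξ)) (by fun_prop))

lemma heatDensity_sliceMeasure_update (μ : Measure (ι → ℝ)) (D : ι → ℝ) (i : ι) (y : ι → ℝ)
    (r x : ℝ) : heatDensity (sliceMeasure μ D i y) r x =
      noisyDensity μ (Function.update D i r) (Function.update y i x) := by
  rw [← heatDensity_sliceMeasure _ _ i, sliceMeasure_update]
  simp

lemma heatDensityDeriv_sliceMeasure_update (μ : Measure (ι → ℝ)) (D : ι → ℝ) (i : ι) (y : ι → ℝ)
    (r x : ℝ) : heatDensityDeriv (sliceMeasure μ D i y) r x =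
      noisyPartial μ (Function.update D i r) i (Function.update y i x) := by
  rw [← heatDensityDeriv_sliceMeasure, sliceMeasure_update]
  simp

end Slice

variable (μ : Measure (ι → ℝ)) [IsFiniteMeasure μ]

lemma measurable_noisyDensity :
    Measurable fun q : (ι → ℝ) × (ι → ℝ) => noisyDensity μ q.1 q.2 :=
  (StronglyMeasurable.integral_prod_right
    (f := fun (q : (ι → ℝ) × (ι → ℝ)) ξ => prodKernel q.1 (q.2 - ξ))
    (measurable_prodKernel.comp (f := fun p : ((ι → ℝ) × (ι → ℝ)) × (ι → ℝ) =>
      (p.1.1, p.1.2 - p.2)) (by fun_prop)).stronglyMeasurable).measurable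

lemma measurable_noisyDensity_right (D : ι → ℝ) : Measurable (noisyDensity μ D) :=
  (measurable_noisyDensity μ).comp (f := fun y => (D, y)) (by fun_prop)

lemma measurable_noisyPartial [DecidableEq ι] (i : ι) :
    Measurable fun q : (ι → ℝ) × (ι → ℝ) => noisyPartial μ q.1 i q.2 := by
  refine (StronglyMeasurable.integral_prod_right
    (f := fun (q : (ι → ℝ) × (ι → ℝ)) (ξ : ι → ℝ) => heatKernelDeriv (q.1 i) (q.2 i - ξ i) *
      ∏ j ∈ Finset.univ.erase i, heatKernel (q.1 j) (q.2 j - ξ j))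
    (Measurable.stronglyMeasurable (Measurable.mul ?_ ?_))).measurable
  · exact measurable_heatKernelDeriv.comp (f := fun p : ((ι → ℝ) × (ι → ℝ)) × (ι → ℝ) =>
      (p.1.1 i, p.1.2 i - p.2 i)) (by fun_prop)
  · exact (measurable_prod_heatKernel (Finset.univ.erase i)).comp
      (f := fun p : ((ι → ℝ) × (ι → ℝ)) × (ι → ℝ) => (p.1.1, p.1.2 - p.2)) (by fun_prop)

lemma integrable_prodKernel_sub {D : ι → ℝ} (hD : ∀ j, 0 < D j) (y : ι → ℝ) :
    Integrable (fun ξ => prodKernel D (y - ξ)) μ := by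
  refine Integrable.of_bound (C := ∏ j, (Real.sqrt (D j))⁻¹) ?_ (ae_of_all _ fun ξ => ?_)
  · exact (measurable_prodKernel.comp (f := fun ξ => (D, y - ξ)) (by fun_prop)).aestronglyMeasurable
  · rw [Real.norm_eq_abs, abs_of_nonneg (prodKernel_nonneg _ _)]
    exact prod_heatKernel_le hD (y - ξ) _

lemma noisyDensity_nonneg (μ : Measure (ι → ℝ)) (D y : ι → ℝ) : 0 ≤ noisyDensity μ D y :=
  integral_nonneg fun _ => prodKernel_nonneg _ _

lemma noisyDensity_pos {μ : Measure (ι → ℝ)} [IsFiniteMeasure μ] (hμ : μ ≠ 0) {D : ι → ℝ}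
    (hD : ∀ j, 0 < D j) (y : ι → ℝ) : 0 < noisyDensity μ D y := by
  rw [noisyDensity, integral_pos_iff_support_of_nonneg (fun _ => prodKernel_nonneg _ _)
    (integrable_prodKernel_sub μ hD y)]
  have : (Function.support fun ξ => prodKernel D (y - ξ)) = Set.univ := by
    ext ξ; simpa using (prodKernel_pos hD _).ne'
  rw [this]
  exact (Measure.measure_univ_pos).2 hμ

end

/-! ### Decrease of Fisher information and transport coordinate by coordinate -/

section

variable {ι : Type*} [Fintype ι]

lemma integrable_mul_prodKernel_sub {μ : Measure (ι → ℝ)} {D : ι → ℝ} (hD : ∀ j, 0 < D j)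
    {f : (ι → ℝ) → ℝ} (hf : Integrable f μ) (y : ι → ℝ) :
    Integrable (fun ξ => f ξ * prodKernel D (y - ξ)) μ := by
  refine hf.mul_bdd (c := ∏ j, (Real.sqrt (D j))⁻¹) ?_ (ae_of_all _ fun ξ => ?_)
  · exact (measurable_prodKernel.comp (f := fun ξ => (D, y - ξ)) (by fun_prop)).aestronglyMeasurable
  · rw [Real.norm_eq_abs, abs_of_nonneg (prodKernel_nonneg _ _)]
    exact prod_heatKernel_le hD (y - ξ) _

variable [DecidableEq ι]

/-- The function `s` has conditional expectation, given any Gaussian observation, equal to the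
score of the observation, in the direction of the coordinate `i`. -/
def IsNoisyScore (μ : Measure (ι → ℝ)) (i : ι) (s : (ι → ℝ) → ℝ) : Prop :=
  ∀ D : ι → ℝ, (∀ j, 0 < D j) → ∀ y,
    noisyPartial μ D i y = ∫ ξ, s ξ * prodKernel D (y - ξ) ∂μ

variable {μ : Measure (ι → ℝ)} [IsFiniteMeasure μ]

/-- Conditional Jensen inequality, unnormalized: Cauchy–Schwarz for `s` with the likelihood
`prodKernel D (y - ξ)` as weight. -/
lemma sq_noisyPartial_div_le {i : ι} {s : (ι → ℝ) → ℝ} (hs : MemLp s 2 μ)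
    (hsc : IsNoisyScore μ i s) {D : ι → ℝ} (hD : ∀ j, 0 < D j) (y : ι → ℝ) :
    ENNReal.ofReal (noisyPartial μ D i y ^ 2 / noisyDensity μ D y) ≤
      ∫⁻ ξ, ENNReal.ofReal (s ξ ^ 2) * ENNReal.ofReal (prodKernel D (y - ξ)) ∂μ := by
  have h1 := integrable_prodKernel_sub μ hD y
  have h2 := integrable_mul_prodKernel_sub hD (hs.integrable one_le_two) y
  have h3 := integrable_mul_prodKernel_sub hD hs.integrable_sq y
  have hcs := sq_integral_mul_le (fun ξ => prodKernel_nonneg D (y - ξ)) h1 h2 h3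
  rw [← hsc D hD y] at hcs
  simp_rw [← ENNReal.ofReal_mul (sq_nonneg _)]
  rw [← ofReal_integral_eq_lintegral_ofReal h3
    (ae_of_all _ fun ξ => mul_nonneg (sq_nonneg _) (prodKernel_nonneg _ _))]
  refine ENNReal.ofReal_le_ofReal ?_
  refine div_le_of_le_mul₀ (noisyDensity_nonneg _ _ _)
    (integral_nonneg fun ξ => mul_nonneg (sq_nonneg _) (prodKernel_nonneg _ _)) ?_
  rwa [mul_comm]

/-- Adding Gaussian noise does not increase the Fisher information. -/
lemma lintegral_sq_noisyPartial_div_le {i : ι} {s : (ι → ℝ) → ℝ} (hs : MemLp s 2 μ)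
    (hsc : IsNoisyScore μ i s) {D : ι → ℝ} (hD : ∀ j, 0 < D j) :
    ∫⁻ y, ENNReal.ofReal (noisyPartial μ D i y ^ 2 / noisyDensity μ D y) ≤
      ∫⁻ ξ, ENNReal.ofReal (s ξ ^ 2) ∂μ := by
  have hm : Measurable fun q : (ι → ℝ) × (ι → ℝ) => ENNReal.ofReal (prodKernel D (q.1 - q.2)) :=
    (measurable_prodKernel.comp (f := fun q : (ι → ℝ) × (ι → ℝ) => (D, q.1 - q.2))
      (by fun_prop)).ennreal_ofReal
  have hs2 : AEMeasurable (fun ξ => ENNReal.ofReal (s ξ ^ 2)) μ :=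
    (hs.aestronglyMeasurable.aemeasurable.pow_const 2).ennreal_ofReal
  calc _ ≤ ∫⁻ y, ∫⁻ ξ, ENNReal.ofReal (s ξ ^ 2) * ENNReal.ofReal (prodKernel D (y - ξ)) ∂μ :=
        lintegral_mono fun y => sq_noisyPartial_div_le hs hsc hD y
    _ = ∫⁻ ξ, (∫⁻ y, ENNReal.ofReal (s ξ ^ 2) * ENNReal.ofReal (prodKernel D (y - ξ))) ∂μ :=
        lintegral_lintegral_swap (hs2.comp_snd.mul hm.aemeasurable)
    _ = _ := by
        refine lintegral_congr fun ξ => ?_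
        have hmξ : Measurable fun y => ENNReal.ofReal (prodKernel D (y - ξ)) :=
          hm.comp (f := fun y => (y, ξ)) (by fun_prop)
        rw [lintegral_const_mul _ hmξ, lintegral_prodKernel_sub hD, mul_one]

/-- The monotone rearrangement of the coordinate `i`, given the other ones, that raises the
variance of the noise of that coordinate to `t`. -/
def coordTransport (μ : Measure (ι → ℝ)) (D : ι → ℝ) (i : ι) (t : ℝ) (y : ι → ℝ) : ι → ℝ :=
  Function.update y i (heatTransport (sliceMeasure μ D i y) (D i) t (y i))

lemma coordTransport_of_ne (μ : Measure (ι → ℝ)) (D : ι → ℝ) {i j : ι} (h : j ≠ i) (t : ℝ)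
    (y : ι → ℝ) : coordTransport μ D i t y j = y j :=
  Function.update_of_ne h _ _

lemma coordTransport_update (μ : Measure (ι → ℝ)) (D : ι → ℝ) (i : ι) (t x : ℝ) (y : ι → ℝ) :
    coordTransport μ D i t (Function.update y i x) =
      Function.update y i (heatTransport (sliceMeasure μ D i y) (D i) t x) := by
  have := sliceMeasure_update μ D i y (D i) x
  rw [Function.update_eq_self] at this
  simp [coordTransport, this]

lemma measurable_heatFlowCDF_sliceMeasure (D : ι → ℝ) (i : ι) (r : ℝ) {f : (ι → ℝ) → ℝ}
    (hf : Measurable f) : Measurable fun y => heatFlowCDF (sliceMeasure μ D i y) r (f y) := by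
  have h : ∀ y, heatFlowCDF (sliceMeasure μ D i y) r (f y) = ∫ ξ, heatCDF r (f y - ξ i) *
      ∏ j ∈ Finset.univ.erase i, heatKernel (D j) (y j - ξ j) ∂μ := fun y =>
    integral_sliceMeasure μ D i y
      (measurable_heatCDF.comp (f := fun ξ : ℝ => (r, f y - ξ)) (by fun_prop))
  simp_rw [h]
  exact (StronglyMeasurable.integral_prod_right
    (f := fun (y : ι → ℝ) (ξ : ι → ℝ) => heatCDF r (f y - ξ i) *
      ∏ j ∈ Finset.univ.erase i, heatKernel (D j) (y j - ξ j))
    (((measurable_heatCDF.comp (f := fun q : (ι → ℝ) × (ι → ℝ) => (r, f q.1 - q.2 i))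
      (by fun_prop)).mul (measurable_sliceWeight D i)).stronglyMeasurable)).measurable

lemma measurable_coordTransport (hμ : μ ≠ 0) {D : ι → ℝ} (hD : ∀ j, 0 < D j)
    (i : ι) {t : ℝ} (ht : 0 < t) :
    Measurable (coordTransport μ D i t) := by
  have hq : Measurable fun y => heatTransport (sliceMeasure μ D i y) (D i) t (y i) := by
    refine measurable_of_Iic fun a => ?_
    have : (fun y => heatTransport (sliceMeasure μ D i y) (D i) t (y i)) ⁻¹' Set.Iic a =
        {y | heatFlowCDF (sliceMeasure μ D i y) (D i) (y i) ≤
          heatFlowCDF (sliceMeasure μ D i y) t a} := by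
      ext y
      have := isFiniteMeasure_sliceMeasure μ hD i y
      exact heatTransport_le_iff (sliceMeasure_ne_zero hμ hD i y) (hD i) ht
    rw [this]
    exact measurableSet_le (measurable_heatFlowCDF_sliceMeasure D i _ (measurable_pi_apply i))
      (measurable_heatFlowCDF_sliceMeasure D i _ measurable_const)
  refine measurable_pi_iff.2 fun j => ?_
  rcases eq_or_ne j i with rfl | h
  · simpa [coordTransport] using hq
  · simpa only [coordTransport_of_ne μ D h] using measurable_pi_apply j

/-- It suffices to compare integrals along lines parallel to axis `i`, where the one-dimensional
change of variables for the slice applies. -/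
lemma map_coordTransport (hμ : μ ≠ 0) {D : ι → ℝ} (hD : ∀ j, 0 < D j)
    (i : ι) {t : ℝ} (ht : 0 < t) :
    (noisyLaw μ D).map (coordTransport μ D i t) = noisyLaw μ (Function.update D i t) := by
  have hT := measurable_coordTransport hμ hD i ht
  refine Measure.ext_of_lintegral _ fun f hf => ?_
  have m1 := (measurable_noisyDensity_right μ D).ennreal_ofReal
  have m2 := (measurable_noisyDensity_right μ (Function.update D i t)).ennreal_ofReal
  have hfT : Measurable fun y => f (coordTransport μ D i t y) := hf.comp hT
  rw [lintegral_map hf hT, noisyLaw, noisyLaw, lintegral_withDensity_eq_lintegral_mul _ m1 hfT,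
    lintegral_withDensity_eq_lintegral_mul _ m2 hf, volume_pi]
  refine lintegral_eq_of_lmarginal_eq {i} (m1.mul hfT) (m2.mul hf) ?_
  rw [lmarginal_singleton, lmarginal_singleton]
  ext y
  have := isFiniteMeasure_sliceMeasure μ hD i y
  have key := lintegral_comp_heatTransport (sliceMeasure_ne_zero hμ hD i y) (hD i) ht
    (f := fun x => f (Function.update y i x)) (hf.comp (measurable_update y))
  simp only [Pi.mul_apply, coordTransport_update]
  simp only [heatDensity_sliceMeasure_update, Function.update_eq_self] at key
  simpa only [mul_comm] using key

/-- The one-dimensional cost is integrated over the remaining coordinates. At every intermediate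
variance the Fisher information is at most that of `μ`, so the time integral gives a second factor
`t - D i`. -/
lemma lintegral_sq_coordTransport_sub_le (hμ : μ ≠ 0) {D : ι → ℝ} (hD : ∀ j, 0 < D j)
    {i : ι} {t : ℝ} (ht : D i ≤ t) {s : (ι → ℝ) → ℝ}
    (hs : MemLp s 2 μ) (hsc : IsNoisyScore μ i s) :
    ∫⁻ y, ENNReal.ofReal ((coordTransport μ D i t y i - y i) ^ 2) ∂(noisyLaw μ D) ≤
      ENNReal.ofReal ((t - D i) ^ 2 / 4) * ∫⁻ ξ, ENNReal.ofReal (s ξ ^ 2) ∂μ := by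
  have ht0 : 0 < t := (hD i).trans_le ht
  have hT := measurable_coordTransport hμ hD i ht0
  have m1 := (measurable_noisyDensity_right μ D).ennreal_ofReal
  have m2 : Measurable fun y => ENNReal.ofReal ((coordTransport μ D i t y i - y i) ^ 2) :=
    ((((measurable_pi_apply i).comp hT).sub (measurable_pi_apply i)).pow_const 2).ennreal_ofReal
  have hu : Measurable fun q : (ι → ℝ) × ℝ => (Function.update D i q.2, q.1) :=
    ((measurable_update D).comp measurable_snd).prodMk measurable_fst
  have m3 : Measurable fun q : (ι → ℝ) × ℝ => ENNReal.ofReal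
      (noisyPartial μ (Function.update D i q.2) i q.1 ^ 2 /
        noisyDensity μ (Function.update D i q.2) q.1) :=
    ((((measurable_noisyPartial μ i).comp hu).pow_const 2).div
      ((measurable_noisyDensity μ).comp hu)).ennreal_ofReal
  have m4 : Measurable fun y => ∫⁻ r in Set.Ioc (D i) t, ENNReal.ofReal
      (noisyPartial μ (Function.update D i r) i y ^ 2 /
        noisyDensity μ (Function.update D i r) y) := m3.lintegral_prod_right'
  rw [noisyLaw, lintegral_withDensity_eq_lintegral_mul _ m1 m2]
  calc _ ≤ ∫⁻ y, ENNReal.ofReal ((t - D i) / 4) * ∫⁻ r in Set.Ioc (D i) t, ENNReal.ofReal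
        (noisyPartial μ (Function.update D i r) i y ^ 2 /
          noisyDensity μ (Function.update D i r) y) := by
        rw [volume_pi]
        refine lintegral_le_of_lmarginal_le {i} (m1.mul m2) (m4.const_mul _) ?_
        rw [lmarginal_singleton, lmarginal_singleton]
        intro y
        have := isFiniteMeasure_sliceMeasure μ hD i y
        have key := lintegral_sq_heatTransport_sub_le (sliceMeasure_ne_zero hμ hD i y) (hD i) ht
        simp only [heatDensity_sliceMeasure_update, heatDensityDeriv_sliceMeasure_update,
          Function.update_eq_self] at key
        simp only [Pi.mul_apply, coordTransport_update, Function.update_self]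
        have m5 : Measurable fun x => ∫⁻ r in Set.Ioc (D i) t, ENNReal.ofReal
            (noisyPartial μ (Function.update D i r) i (Function.update y i x) ^ 2 /
              noisyDensity μ (Function.update D i r) (Function.update y i x)) :=
          m4.comp (measurable_update y)
        rw [lintegral_const_mul _ m5]
        simpa only [mul_comm (ENNReal.ofReal (noisyDensity μ D _))] using key
    _ = ENNReal.ofReal ((t - D i) / 4) * ∫⁻ r in Set.Ioc (D i) t, ∫⁻ y, ENNReal.ofReal
        (noisyPartial μ (Function.update D i r) i y ^ 2 /
          noisyDensity μ (Function.update D i r) y) := by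
        rw [lintegral_const_mul _ m4, lintegral_lintegral_swap m3.aemeasurable]
    _ ≤ ENNReal.ofReal ((t - D i) / 4) * ∫⁻ r in Set.Ioc (D i) t,
        ∫⁻ ξ, ENNReal.ofReal (s ξ ^ 2) ∂μ := by
        refine mul_le_mul_right ?_ _
        refine setLIntegral_mono measurable_const fun r hr => ?_
        refine lintegral_sq_noisyPartial_div_le hs hsc fun j => ?_
        rcases eq_or_ne j i with rfl | h
        · simpa using (hD j).trans hr.1
        · simpa [h] using hD j
    _ = _ := by
        rw [setLIntegral_const, Real.volume_Ioc, mul_comm (∫⁻ ξ, _ ∂μ), ← mul_assoc,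
          ← ENNReal.ofReal_mul (by linarith)]
        congr 2
        ring

/-- A transport map between two times of the heat flow, whose squared cost is bounded by the Fisher
information of the initial measure. -/
theorem exists_transport (hμ : μ ≠ 0) {s : ι → (ι → ℝ) → ℝ} (hs : ∀ i, MemLp (s i) 2 μ)
    (hsc : ∀ i, IsNoisyScore μ i (s i)) {a b : ℝ} (ha : 0 < a) (hab : a ≤ b) :
    ∃ T : (ι → ℝ) → (ι → ℝ), Measurable T ∧
      (noisyLaw μ fun _ => a).map T = noisyLaw μ (fun _ => b) ∧
      ∫⁻ y, ∑ i, ENNReal.ofReal ((T y i - y i) ^ 2) ∂(noisyLaw μ fun _ => a) ≤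
        ENNReal.ofReal ((b - a) ^ 2 / 4) * ∑ i, ∫⁻ ξ, ENNReal.ofReal (s i ξ ^ 2) ∂μ := by
  -- `S` is the set of coordinates whose variance has already been raised to `b`. The clause that
  -- `T` fixes the others is what makes the costs add.
  have key : ∀ S : Finset ι, ∃ T : (ι → ℝ) → (ι → ℝ), Measurable T ∧
      (∀ y, ∀ j ∉ S, T y j = y j) ∧
      (noisyLaw μ fun _ => a).map T = noisyLaw μ (fun j => if j ∈ S then b else a) ∧
      ∫⁻ y, ∑ i ∈ S, ENNReal.ofReal ((T y i - y i) ^ 2) ∂(noisyLaw μ fun _ => a) ≤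
        ENNReal.ofReal ((b - a) ^ 2 / 4) * ∑ i ∈ S, ∫⁻ ξ, ENNReal.ofReal (s i ξ ^ 2) ∂μ := by
    intro S
    induction S using Finset.induction_on with
    | empty => exact ⟨id, measurable_id, fun _ _ _ => rfl, by simp, by simp⟩
    | insert i S hi ih =>
      obtain ⟨T, hT, hTid, hmap, hcost⟩ := ih
      set D : ι → ℝ := fun j => if j ∈ S then b else a with hDdef
      have hD : ∀ j, 0 < D j := fun j => by
        simp only [hDdef]; split_ifs <;> linarith
      have hDi : D i = a := by simp [hDdef, hi]
      have hb : 0 < b := ha.trans_le hab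
      have hR := measurable_coordTransport hμ hD i hb
      have hne : ∀ y, ∀ j ∈ S, coordTransport μ D i b (T y) j = T y j := fun y j hj =>
        coordTransport_of_ne μ D (fun h => hi (by rwa [← h])) b _
      refine ⟨fun y => coordTransport μ D i b (T y), hR.comp hT, fun y j hj => ?_, ?_, ?_⟩
      · rw [Finset.mem_insert, not_or] at hj
        exact (coordTransport_of_ne μ D hj.1 b _).trans (hTid y j hj.2)
      · have : (fun y => coordTransport μ D i b (T y)) = coordTransport μ D i b ∘ T := rfl
        rw [this, ← Measure.map_map hR hT, hmap, map_coordTransport hμ hD i hb]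
        congr 1
        ext j
        rcases eq_or_ne j i with rfl | h
        · simp
        · simp [hDdef, h]
      · have hm : Measurable fun z =>
            ENNReal.ofReal ((coordTransport μ D i b z i - z i) ^ 2) :=
          ((((measurable_pi_apply i).comp hR).sub
            (measurable_pi_apply i)).pow_const 2).ennreal_ofReal
        have hmT : Measurable fun y =>
            ENNReal.ofReal ((coordTransport μ D i b (T y) i - T y i) ^ 2) := hm.comp hT
        have h1 := lintegral_sq_coordTransport_sub_le hμ hD (hDi.le.trans hab) (hs i) (hsc i)
        rw [← hmap, lintegral_map hm hT, hDi] at h1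
        -- The new map moves only coordinate `i`, which `T` has left in place, so no cross term
        -- arises.
        have h2 : ∀ y, ∑ j ∈ insert i S,
            ENNReal.ofReal ((coordTransport μ D i b (T y) j - y j) ^ 2) =
            ENNReal.ofReal ((coordTransport μ D i b (T y) i - T y i) ^ 2) +
              ∑ j ∈ S, ENNReal.ofReal ((T y j - y j) ^ 2) := fun y => by
          rw [Finset.sum_insert hi, ← hTid y i hi]
          congr 1
          exact Finset.sum_congr rfl fun j hj => by rw [hne y j hj]
        simp_rw [h2]
        rw [lintegral_add_left hmT, Finset.sum_insert hi, mul_add]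
        exact add_le_add h1 hcost
  obtain ⟨T, hT, -, hmap, hcost⟩ := key Finset.univ
  exact ⟨T, hT, by simpa using hmap, hcost⟩

end

/-! ### From the weak gradient to the score of the observation -/

section

open scoped ContDiff

lemma hasDerivAt_heatKernel {r : ℝ} (hr : 0 < r) (z : ℝ) :
    HasDerivAt (heatKernel r) (heatKernelDeriv r z) z := by
  have h1 : HasDerivAt (fun z : ℝ => -z ^ 2 / (2 * r)) (-(z / r)) z := by
    refine (((hasDerivAt_id z).pow 2).neg.div_const (2 * r)).congr_deriv ?_
    simp; field_simp
  refine (h1.exp.const_mul (Real.sqrt (2 * Real.pi * r))⁻¹).congr_deriv ?_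
  unfold heatKernelDeriv heatKernel; ring

lemma contDiff_heatKernel (r : ℝ) : ContDiff ℝ ∞ (heatKernel r) := by
  unfold heatKernel; fun_prop

variable {d : ℕ}

/-- Test functions in the definition of an integrable weak gradient need not have compact support:
it suffices that they are bounded and have a bounded derivative. -/
lemma HasWeakGradient.integral_mul_fderiv {f : EuclideanSpace ℝ (Fin d) → ℝ}
    {g : EuclideanSpace ℝ (Fin d) → EuclideanSpace ℝ (Fin d)}
    (h : HasWeakGradient f g) (hf : Integrable f) (hg : Integrable g)
    {G : EuclideanSpace ℝ (Fin d) → ℝ}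
    (hG : ContDiff ℝ ∞ G) {A B : ℝ} (hA : ∀ x, |G x| ≤ A) (v : EuclideanSpace ℝ (Fin d))
    (hB : ∀ x, |fderiv ℝ G x v| ≤ B) :
    ∫ x, f x * fderiv ℝ G x v = -∫ x, G x * inner ℝ (g x) v := by
  -- The dilated cutoffs `χ (c n • x)` tend to `1` pointwise and their derivatives are of order `c
  -- n`. Dominated convergence removes them, thanks to the integrability of `f` and `g`.
  let χ : ContDiffBump (0 : EuclideanSpace ℝ (Fin d)) := ⟨1, 2, one_pos, one_lt_two⟩
  have hχ : ContDiff ℝ ∞ χ := χ.contDiff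
  obtain ⟨M, hM⟩ : ∃ M, ∀ x, ‖fderiv ℝ χ x‖ ≤ M :=
    (χ.hasCompactSupport.fderiv (𝕜 := ℝ)).exists_bound_of_continuous
      (hχ.continuous_fderiv (by simp))
  let c : ℕ → ℝ := fun n => ((n : ℝ) + 1)⁻¹
  have hc0 : ∀ n, 0 < c n := fun n => by positivity
  have hc1 : ∀ n, c n ≤ 1 := fun n => inv_le_one_of_one_le₀ (by simp)
  have hc : Tendsto c atTop (𝓝 0) := by
    simpa [c] using tendsto_one_div_add_atTop_nhds_zero_nat (𝕜 := ℝ)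
  let X : ℕ → EuclideanSpace ℝ (Fin d) → ℝ := fun n x => χ (c n • x)
  have hX : ∀ n, ContDiff ℝ ∞ (X n) := fun n => hχ.comp (contDiff_const_smul (c n))
  have hXsupp : ∀ n, HasCompactSupport (X n) := fun n =>
    χ.hasCompactSupport.comp_smul (hc0 n).ne'
  have hX0 : ∀ n x, |X n x| ≤ 1 := fun n x => by
    rw [abs_of_nonneg χ.nonneg]; exact χ.le_one
  have hdX : ∀ n x, fderiv ℝ (X n) x v = c n * fderiv ℝ χ (c n • x) v := fun n x => by
    have h1 : HasFDerivAt (X n) ((fderiv ℝ χ (c n • x)).comp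
        (c n • ContinuousLinearMap.id ℝ (EuclideanSpace ℝ (Fin d)))) x :=
      ((hχ.differentiable (by simp)) _).hasFDerivAt.comp x
        ((hasFDerivAt_id x).const_smul (c n))
    rw [h1.fderiv]
    simp
  have hM0 : 0 ≤ M := (norm_nonneg _).trans (hM 0)
  have hdXb : ∀ n x, |fderiv ℝ (X n) x v| ≤ c n * (M * ‖v‖) := fun n x => by
    rw [hdX, abs_mul, abs_of_pos (hc0 n)]
    gcongr
    exact ((fderiv ℝ χ (c n • x)).le_opNorm v).trans
      (mul_le_mul_of_nonneg_right (hM _) (norm_nonneg v))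
  have hXlim : ∀ x, Tendsto (fun n => X n x) atTop (𝓝 1) := fun x => by
    have h1 : Tendsto (fun n => χ (c n • x)) atTop (𝓝 (χ ((0 : ℝ) • x))) :=
      (hχ.continuous.tendsto _).comp (hc.smul_const x)
    rw [zero_smul, χ.one_of_mem_closedBall (by simp [χ])] at h1
    exact h1
  have hdXlim : ∀ x, Tendsto (fun n => fderiv ℝ (X n) x v) atTop (𝓝 0) := fun x => by
    have h1 : Tendsto (fun n => c n * (M * ‖v‖)) atTop (𝓝 0) := by
      simpa using hc.mul_const (M * ‖v‖)
    exact squeeze_zero_norm (fun n => hdXb n x) h1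
  have hGd : Differentiable ℝ G := hG.differentiable (by simp)
  have hXd : ∀ n, Differentiable ℝ (X n) := fun n => (hX n).differentiable (by simp)
  have hprod : ∀ n x, fderiv ℝ (fun x => X n x * G x) x v =
      X n x * fderiv ℝ G x v + G x * fderiv ℝ (X n) x v := fun n x => by
    have := ((hXd n x).hasFDerivAt.mul (hGd x).hasFDerivAt).fderiv
    simp only [Pi.mul_def] at this
    rw [this]; simp
  have hA0 : 0 ≤ A := (abs_nonneg _).trans (hA 0)
  have hB0 : 0 ≤ B := (abs_nonneg _).trans (hB 0)
  have hdGc : Continuous fun x => fderiv ℝ G x v :=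
    (hG.continuous_fderiv (by simp)).clm_apply continuous_const
  have hdXc : ∀ n, Continuous fun x => fderiv ℝ (X n) x v := fun n =>
    ((hX n).continuous_fderiv (by simp)).clm_apply continuous_const
  have key : ∀ n, ∫ x, f x * (X n x * fderiv ℝ G x v + G x * fderiv ℝ (X n) x v) =
      -∫ x, X n x * G x * inner ℝ (g x) v := fun n => by
    have := h.2.2 (fun x => X n x * G x) ((hX n).mul hG) ((hXsupp n).mul_right) v
    simpa only [hprod] using this
  have l1 : Tendsto (fun n => ∫ x, f x * (X n x * fderiv ℝ G x v + G x * fderiv ℝ (X n) x v))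
      atTop (𝓝 (∫ x, f x * fderiv ℝ G x v)) := by
    refine tendsto_integral_of_dominated_convergence
      (fun x => ‖f x‖ * (B + A * (M * ‖v‖))) (fun n => ?_) (hf.norm.mul_const _) (fun n => ?_) ?_
    · exact hf.aestronglyMeasurable.mul ((((hX n).continuous.mul hdGc).add
        (hG.continuous.mul (hdXc n))).aestronglyMeasurable)
    · refine ae_of_all _ fun x => ?_
      rw [norm_mul]
      gcongr
      rw [Real.norm_eq_abs]
      refine (abs_add_le _ _).trans (add_le_add ?_ ?_)
      · rw [abs_mul]
        calc _ ≤ 1 * B := mul_le_mul (hX0 n x) (hB x) (abs_nonneg _) zero_le_one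
          _ = B := one_mul B
      · rw [abs_mul]
        refine mul_le_mul (hA x) ((hdXb n x).trans ?_) (abs_nonneg _) hA0
        calc _ ≤ 1 * (M * ‖v‖) := mul_le_mul_of_nonneg_right (hc1 n) (by positivity)
          _ = _ := one_mul _
    · refine ae_of_all _ fun x => ?_
      have := (((hXlim x).mul_const (fderiv ℝ G x v)).add
        ((hdXlim x).const_mul (G x))).const_mul (f x)
      simpa using this
  have l2 : Tendsto (fun n => -∫ x, X n x * G x * inner ℝ (g x) v) atTop
      (𝓝 (-∫ x, G x * inner ℝ (g x) v)) := by
    have hgv : Integrable fun x => inner ℝ (g x) v := hg.inner_const v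
    refine (tendsto_integral_of_dominated_convergence
      (fun x => A * ‖inner ℝ (g x) v‖) (fun n => ?_) (hgv.norm.const_mul _) (fun n => ?_) ?_).neg
    · exact ((hX n).continuous.mul hG.continuous).aestronglyMeasurable.mul hgv.aestronglyMeasurable
    · refine ae_of_all _ fun x => ?_
      rw [norm_mul, Real.norm_eq_abs, abs_mul]
      gcongr
      calc _ ≤ 1 * A := mul_le_mul (hX0 n x) (hA x) (abs_nonneg _) zero_le_one
        _ = A := one_mul A
    · refine ae_of_all _ fun x => ?_
      have := ((hXlim x).mul_const (G x)).mul_const (inner ℝ (g x) v)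
      simpa using this
  exact tendsto_nhds_unique l1 (by simpa only [key] using l2)

lemma integral_eq_integral_density {m : Measure (EuclideanSpace ℝ (Fin d))}
    {p : EuclideanSpace ℝ (Fin d) → ℝ} (hp : IsDensity m p)
    (f : EuclideanSpace ℝ (Fin d) → ℝ) : ∫ x, f x ∂m = ∫ x, p x * f x := by
  rw [hp.2.2, integral_withDensity_eq_integral_toReal_smul hp.1.ennreal_ofReal
    (ae_of_all _ fun _ => ENNReal.ofReal_lt_top)]
  refine integral_congr_ae (ae_of_all _ fun x => ?_)
  simp only [smul_eq_mul]
  rw [ENNReal.toReal_ofReal (hp.2.1 x)]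

lemma integrable_iff_integrable_density {F : Type*} [NormedAddCommGroup F] [NormedSpace ℝ F]
    {m : Measure (EuclideanSpace ℝ (Fin d))}
    {p : EuclideanSpace ℝ (Fin d) → ℝ} (hp : IsDensity m p)
    {f : EuclideanSpace ℝ (Fin d) → F} : Integrable f m ↔ Integrable fun x => p x • f x := by
  rw [hp.2.2, integrable_withDensity_iff_integrable_smul' hp.1.ennreal_ofReal
    (ae_of_all _ fun _ => ENNReal.ofReal_lt_top)]
  simp_rw [ENNReal.toReal_ofReal (hp.2.1 _)]

lemma IsDensity.ae_pos {m : Measure (EuclideanSpace ℝ (Fin d))}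
    {p : EuclideanSpace ℝ (Fin d) → ℝ} (hp : IsDensity m p) :
    ∀ᵐ x ∂m, 0 < p x := by
  rw [hp.2.2, ae_withDensity_iff hp.1.ennreal_ofReal]
  exact ae_of_all _ fun x hx => by simpa using hx

/-- Only `p • s` is known to be measurable; `s` is recovered by dividing by `p`, which is positive
almost everywhere for `m`. -/
lemma IsScore.aestronglyMeasurable {m : Measure (EuclideanSpace ℝ (Fin d))}
    {p : EuclideanSpace ℝ (Fin d) → ℝ} (hp : IsDensity m p)
    {s : EuclideanSpace ℝ (Fin d) → EuclideanSpace ℝ (Fin d)} (hs : IsScore p s) :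
    AEStronglyMeasurable s m := by
  have h1 : AEStronglyMeasurable (fun x => p x • s x) m := by
    refine hs.2.1.aestronglyMeasurable.mono_ac ?_
    rw [hp.2.2]; exact withDensity_absolutelyContinuous _ _
  have h2 : AEStronglyMeasurable (fun x => (p x)⁻¹ • p x • s x) m :=
    hp.1.inv.aestronglyMeasurable.smul h1
  refine h2.congr ?_
  filter_upwards [hp.ae_pos] with x hx
  rw [smul_smul, inv_mul_cancel₀ hx.ne', one_smul]

lemma contDiff_prodKernel (D : Fin d → ℝ) :
    ContDiff ℝ ∞ (fun z : EuclideanSpace ℝ (Fin d) => prodKernel D z.ofLp) := by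
  unfold prodKernel
  exact contDiff_prod fun j _ => (contDiff_heatKernel (D j)).comp (by fun_prop)

lemma fderiv_prodKernel_single {D : Fin d → ℝ} (hD : ∀ j, 0 < D j) (i : Fin d)
    (z : EuclideanSpace ℝ (Fin d)) :
    fderiv ℝ (fun z : EuclideanSpace ℝ (Fin d) => prodKernel D z.ofLp) z
      (EuclideanSpace.single i 1) =
      heatKernelDeriv (D i) (z i) * ∏ j ∈ Finset.univ.erase i, heatKernel (D j) (z j) := by
  rw [← ((contDiff_prodKernel D).differentiable (by simp) z).lineDeriv_eq_fderiv]
  have h1 : ∀ t : ℝ, prodKernel D (z + t • EuclideanSpace.single i (1 : ℝ)).ofLp =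
      heatKernel (D i) (z i + t) *
        ∏ j ∈ Finset.univ.erase i, heatKernel (D j) (z j) := fun t => by
    rw [prodKernel, ← Finset.mul_prod_erase Finset.univ _ (Finset.mem_univ i)]
    congr 1
    · simp
    · refine Finset.prod_congr rfl fun j hj => ?_
      simp [Finset.ne_of_mem_erase hj]
  rw [lineDeriv]
  simp_rw [h1]
  have h2 := ((hasDerivAt_heatKernel (hD i) (z i + 0)).comp_const_add (z i) 0).mul_const
    (∏ j ∈ Finset.univ.erase i, heatKernel (D j) (z j))
  rw [h2.deriv]
  simp

lemma abs_fderiv_prodKernel_single_le {D : Fin d → ℝ} (hD : ∀ j, 0 < D j) (i : Fin d)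
    (z : EuclideanSpace ℝ (Fin d)) :
    |fderiv ℝ (fun z : EuclideanSpace ℝ (Fin d) => prodKernel D z.ofLp) z
      (EuclideanSpace.single i 1)| ≤
      (D i)⁻¹ * ∏ j ∈ Finset.univ.erase i, (Real.sqrt (D j))⁻¹ := by
  have h0 : 0 ≤ ∏ j ∈ Finset.univ.erase i, heatKernel (D j) (z j) :=
    Finset.prod_nonneg fun _ _ => heatKernel_nonneg _ _
  rw [fderiv_prodKernel_single hD, abs_mul, abs_of_nonneg h0]
  exact mul_le_mul (abs_heatKernelDeriv_le (hD i) le_rfl _) (prod_heatKernel_le hD z.ofLp _) h0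
    (inv_nonneg.2 (hD i).le)

lemma norm_fderiv_prodKernel_le {D : Fin d → ℝ} (hD : ∀ j, 0 < D j)
    (z : EuclideanSpace ℝ (Fin d)) :
    ‖fderiv ℝ (fun z : EuclideanSpace ℝ (Fin d) => prodKernel D z.ofLp) z‖ ≤
      ∑ i, (D i)⁻¹ * ∏ j ∈ Finset.univ.erase i, (Real.sqrt (D j))⁻¹ := by
  refine ContinuousLinearMap.opNorm_le_bound _ (Finset.sum_nonneg fun i _ =>
    mul_nonneg (inv_nonneg.2 (hD i).le) (Finset.prod_nonneg fun _ _ => by positivity)) fun v => ?_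
  have hv : v = ∑ i, v i • EuclideanSpace.single i (1 : ℝ) := by
    simpa using ((EuclideanSpace.basisFun (Fin d) ℝ).sum_repr v).symm
  conv_lhs => rw [hv]
  rw [map_sum, Finset.sum_mul]
  refine (norm_sum_le _ _).trans (Finset.sum_le_sum fun i _ => ?_)
  rw [map_smul, norm_smul, mul_comm]
  exact mul_le_mul (abs_fderiv_prodKernel_single_le hD i z) (PiLp.norm_apply_le v i)
    (norm_nonneg _) (mul_nonneg (inv_nonneg.2 (hD i).le)
      (Finset.prod_nonneg fun _ _ => by positivity))

/-- The score of an observation with Gaussian noise is the conditional expectation of the score. -/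
lemma IsScore.isNoisyScore {m : Measure (EuclideanSpace ℝ (Fin d))} [IsFiniteMeasure m]
    {p : EuclideanSpace ℝ (Fin d) → ℝ} (hp : IsDensity m p)
    {s : EuclideanSpace ℝ (Fin d) → EuclideanSpace ℝ (Fin d)} (hs : IsScore p s)
    (hint : Integrable s m)
    (i : Fin d) :
    IsNoisyScore (m.map WithLp.ofLp) i (fun ξ => s (WithLp.toLp 2 ξ) i) := by
  intro D hD y
  have hpint : Integrable p := by
    have := (integrable_iff_integrable_density hp (f := fun _ => (1 : ℝ))).1 (integrable_const _)
    simpa using this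
  have hsint : Integrable fun x => p x • s x := (integrable_iff_integrable_density hp).1 hint
  set g := fun z : EuclideanSpace ℝ (Fin d) => prodKernel D z.ofLp with hg
  have hgd : Differentiable ℝ g := (contDiff_prodKernel D).differentiable (by simp)
  have hfd : ∀ x, fderiv ℝ (fun x => g (WithLp.toLp 2 y - x)) x (EuclideanSpace.single i 1) =
      -fderiv ℝ g (WithLp.toLp 2 y - x) (EuclideanSpace.single i 1) := fun x => by
    have h1 : HasFDerivAt (fun x => g (WithLp.toLp 2 y - x)) _ x :=
      (hgd (WithLp.toLp 2 y - x)).hasFDerivAt.comp x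
        ((hasFDerivAt_id x).const_sub (WithLp.toLp 2 y))
    rw [h1.fderiv]
    simp
  -- The test function is `x ↦ prodKernel D (y - x)`. The sign from its chain rule cancels the one
  -- from integration by parts.
  have key := HasWeakGradient.integral_mul_fderiv hs hpint hsint
    (G := fun x => g (WithLp.toLp 2 y - x))
    ((contDiff_prodKernel D).comp (contDiff_const.sub contDiff_id))
    (A := ∏ j, (Real.sqrt (D j))⁻¹)
    (fun x => by
      rw [abs_of_nonneg (prodKernel_nonneg _ _)]
      exact prod_heatKernel_le hD _ _) (EuclideanSpace.single i 1)
    (fun x => by rw [hfd, abs_neg]; exact abs_fderiv_prodKernel_single_le hD i _)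
  have hemb : MeasurableEmbedding (WithLp.ofLp : EuclideanSpace ℝ (Fin d) → Fin d → ℝ) :=
    (MeasurableEquiv.toLp 2 (Fin d → ℝ)).symm.measurableEmbedding
  rw [noisyPartial, hemb.integral_map, hemb.integral_map, integral_eq_integral_density hp,
    integral_eq_integral_density hp]
  simp_rw [hfd, hg, fderiv_prodKernel_single hD, mul_neg, integral_neg, neg_inj] at key
  simp only [PiLp.sub_apply, WithLp.ofLp_sub] at key
  rw [key]
  refine integral_congr_ae (ae_of_all _ fun x => ?_)
  simp [inner_smul_left, EuclideanSpace.inner_single_right]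
  ring

end

/-! ### Gaussian laws and the gradient of the noisy density -/

section

open scoped ContDiff

section GaussianLaw

variable {ι : Type*} [Fintype ι]

/-- The centred Gaussian law with independent coordinates of variance `r`. -/
def isoGaussian (ι : Type*) [Fintype ι] (r : ℝ) : Measure (ι → ℝ) :=
  Measure.pi fun _ => gaussianReal 0 r.toNNReal

instance (r : ℝ) : IsProbabilityMeasure (isoGaussian ι r) := by
  unfold isoGaussian; infer_instance

lemma isoGaussian_eq_withDensity {r : ℝ} (hr : 0 < r) :
    isoGaussian ι r = volume.withDensity fun z => ENNReal.ofReal (prodKernel (fun _ => r) z) := by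
  refine Measure.pi_eq fun s hs => ?_
  rw [withDensity_apply _ (MeasurableSet.univ_pi hs), volume_pi, Measure.restrict_pi_pi]
  unfold prodKernel
  rw [lintegral_ofReal_prod (fun _ => (integrable_heatKernel hr).restrict)
    fun _ _ => heatKernel_nonneg _ _]
  refine Finset.prod_congr rfl fun i _ => ?_
  rw [gaussianReal_apply 0 (by simpa using hr)]
  simp [gaussianPDF, heatKernel_eq_gaussianPDFReal hr]

lemma map_add_isoGaussian (μ : Measure (ι → ℝ)) [IsFiniteMeasure μ] {r : ℝ} (hr : 0 < r) :
    (μ.prod (isoGaussian ι r)).map (fun q => q.1 + q.2) = noisyLaw μ fun _ => r := by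
  refine Measure.ext_of_lintegral _ fun f hf => ?_
  have m1 : Measurable fun z : ι → ℝ => ENNReal.ofReal (prodKernel (fun _ => r) z) :=
    (measurable_prodKernel.comp (f := fun z : ι → ℝ => (fun _ => r, z))
      (by fun_prop)).ennreal_ofReal
  have m2 : Measurable fun q : (ι → ℝ) × (ι → ℝ) =>
      ENNReal.ofReal (prodKernel (fun _ => r) (q.2 - q.1)) * f q.2 :=
    (m1.comp (measurable_snd.sub measurable_fst)).mul (hf.comp measurable_snd)
  have m3 : ∀ ξ : ι → ℝ, Measurable fun z => f (ξ + z) := fun ξ =>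
    hf.comp (measurable_const_add ξ)
  have hD : ∀ _ : ι, 0 < r := fun _ => hr
  rw [lintegral_map hf (by fun_prop), lintegral_prod _ (by fun_prop), noisyLaw,
    lintegral_withDensity_eq_lintegral_mul _ (measurable_noisyDensity_right μ _).ennreal_ofReal hf]
  calc _ = ∫⁻ ξ, (∫⁻ y, ENNReal.ofReal (prodKernel (fun _ => r) (y - ξ)) * f y) ∂μ := by
        refine lintegral_congr fun ξ => ?_
        rw [isoGaussian_eq_withDensity hr, lintegral_withDensity_eq_lintegral_mul _ m1 (m3 ξ),
          ← lintegral_sub_right_eq_self _ ξ]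
        simp
    _ = ∫⁻ y, ∫⁻ ξ, ENNReal.ofReal (prodKernel (fun _ => r) (y - ξ)) * f y ∂μ :=
        lintegral_lintegral_swap m2.aemeasurable
    _ = _ := by
        refine lintegral_congr fun y => ?_
        have m4 : Measurable fun ξ : ι → ℝ => ENNReal.ofReal (prodKernel (fun _ => r) (y - ξ)) :=
          m1.comp (measurable_const.sub measurable_id)
        rw [lintegral_mul_const _ m4, Pi.mul_apply, noisyDensity,
          ofReal_integral_eq_lintegral_ofReal (integrable_prodKernel_sub μ hD y)
            (ae_of_all _ fun _ => prodKernel_nonneg _ _)]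

lemma lintegral_sum_sq_isoGaussian {r : ℝ} (hr : 0 ≤ r) :
    ∫⁻ z, ∑ i, ENNReal.ofReal (z i ^ 2) ∂(isoGaussian ι r) =
      ENNReal.ofReal (Fintype.card ι * r) := by
  rw [lintegral_finsetSum _ fun i _ => by fun_prop]
  have h : ∀ i, ∫⁻ z, ENNReal.ofReal (z i ^ 2) ∂(isoGaussian ι r) = ENNReal.ofReal r := fun i => by
    have h1 := (measurePreserving_eval (fun _ : ι => gaussianReal 0 r.toNNReal) i).lintegral_comp
      (f := fun x => ENNReal.ofReal (x ^ 2)) (by fun_prop)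
    have h2 : ∫ x, x ^ 2 ∂(gaussianReal 0 r.toNNReal) = r := by
      have := variance_id_gaussianReal (μ := 0) (v := r.toNNReal)
      rw [variance_eq_integral aemeasurable_id] at this
      simpa [integral_id_gaussianReal, hr] using this
    have h3 : Integrable (fun x => x ^ 2) (gaussianReal 0 r.toNNReal) :=
      (memLp_id_gaussianReal (μ := 0) (v := r.toNNReal) 2).integrable_sq
    rw [isoGaussian]
    refine h1.trans ?_
    rw [← ofReal_integral_eq_lintegral_ofReal h3 (ae_of_all _ fun _ => sq_nonneg _), h2]
  simp [h, ENNReal.ofReal_mul]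

/-- Both characteristic functions equal `exp (-r ‖t‖² / 2)`. -/
lemma multivariateGaussian_eq_map_isoGaussian [DecidableEq ι] {r : ℝ} (hr : 0 ≤ r) :
    multivariateGaussian 0 (r • (1 : Matrix ι ι ℝ)) =
      (isoGaussian ι r).map (WithLp.toLp 2) := by
  have hS : (r • (1 : Matrix ι ι ℝ)).PosSemidef := Matrix.PosSemidef.one.smul hr
  apply Measure.ext_of_charFun
  ext t
  rw [charFun_multivariateGaussian hS, isoGaussian, charFun_pi]
  simp_rw [charFun_gaussianReal, ← Complex.exp_sum]
  congr 1
  simp [Matrix.smul_mulVec, dotProduct, Finset.sum_div, hr,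
    Finset.sum_neg_distrib]
  refine Finset.sum_congr rfl fun i _ => ?_
  ring

end GaussianLaw

variable {d : ℕ}

/-- `gradient` is defined through the Fréchet derivative, so the existence of partial derivatives
would not suffice; its values on the basis vectors are all that is used later. -/
lemma hasFDerivAt_noisyDensity (μ : Measure (Fin d → ℝ)) [IsFiniteMeasure μ] {D : Fin d → ℝ}
    (hD : ∀ j, 0 < D j) (y : EuclideanSpace ℝ (Fin d)) :
    ∃ L : EuclideanSpace ℝ (Fin d) →L[ℝ] ℝ,
      HasFDerivAt (fun y : EuclideanSpace ℝ (Fin d) => noisyDensity μ D y.ofLp) L y ∧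
      ∀ i, L (EuclideanSpace.single i 1) = noisyPartial μ D i y.ofLp := by
  set g := fun z : EuclideanSpace ℝ (Fin d) => prodKernel D z.ofLp with hg
  have hgC : ContDiff ℝ ∞ g := contDiff_prodKernel D
  have hgd : Differentiable ℝ g := hgC.differentiable (by simp)
  have hcont : Continuous fun ξ : Fin d → ℝ => y - WithLp.toLp 2 ξ :=
    continuous_const.sub (PiLp.continuous_toLp 2 _)
  have hm : AEStronglyMeasurable (fun ξ => fderiv ℝ g (y - WithLp.toLp 2 ξ)) μ :=
    ((hgC.continuous_fderiv (by simp)).comp hcont).aestronglyMeasurable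
  have hF'int : Integrable (fun ξ => fderiv ℝ g (y - WithLp.toLp 2 ξ)) μ :=
    Integrable.of_bound hm _ (ae_of_all _ fun ξ => norm_fderiv_prodKernel_le hD _)
  refine ⟨∫ ξ, fderiv ℝ g (y - WithLp.toLp 2 ξ) ∂μ, ?_, fun i => ?_⟩
  · refine hasFDerivAt_integral_of_dominated_of_fderiv_le (s := Set.univ) univ_mem
      (F := fun y ξ => prodKernel D (y.ofLp - ξ))
      (F' := fun y ξ => fderiv ℝ g (y - WithLp.toLp 2 ξ))
      (Eventually.of_forall fun x => (integrable_prodKernel_sub μ hD x.ofLp).aestronglyMeasurable)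
      (integrable_prodKernel_sub μ hD y.ofLp) hm
      (ae_of_all _ fun ξ x _ => norm_fderiv_prodKernel_le hD _) (integrable_const _)
      (ae_of_all _ fun ξ x _ => ?_)
    exact (hgd (x - WithLp.toLp 2 ξ)).hasFDerivAt.comp x ((hasFDerivAt_id x).sub_const _)
  · rw [ContinuousLinearMap.integral_apply hF'int]
    exact integral_congr_ae (ae_of_all _ fun ξ => fderiv_prodKernel_single hD i _)

/-- The squared norm of the score of the observation in terms of the partial derivatives of its
density. -/
lemma sq_norm_gradient_log_noisyDensity {μ : Measure (Fin d → ℝ)} [IsFiniteMeasure μ] (hμ : μ ≠ 0)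
    {D : Fin d → ℝ} (hD : ∀ j, 0 < D j) (y : EuclideanSpace ℝ (Fin d)) :
    ‖gradient (fun z : EuclideanSpace ℝ (Fin d) => Real.log (noisyDensity μ D z.ofLp)) y‖ ^ 2 =
      ∑ i, (noisyPartial μ D i y.ofLp / noisyDensity μ D y.ofLp) ^ 2 := by
  obtain ⟨L, hL, hLi⟩ := hasFDerivAt_noisyDensity μ hD y
  have h := hL.log (noisyDensity_pos hμ hD y.ofLp).ne'
  rw [EuclideanSpace.real_norm_sq_eq]
  refine Finset.sum_congr rfl fun i _ => ?_
  have h1 := inner_gradient_left (𝕜 := ℝ)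
    (f := fun z : EuclideanSpace ℝ (Fin d) => Real.log (noisyDensity μ D z.ofLp)) (x := y)
    (y := EuclideanSpace.single i 1)
  rw [h.fderiv, EuclideanSpace.inner_single_right] at h1
  simp only [one_mul, conj_trivial, smul_apply, smul_eq_mul, hLi] at h1
  rw [h1]
  ring

lemma continuous_noisyDensity (μ : Measure (Fin d → ℝ)) [IsFiniteMeasure μ] {D : Fin d → ℝ}
    (hD : ∀ j, 0 < D j) :
    Continuous fun y : EuclideanSpace ℝ (Fin d) => noisyDensity μ D y.ofLp :=
  continuous_iff_continuousAt.2 fun y =>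
    (hasFDerivAt_noisyDensity μ hD y).choose_spec.1.continuousAt

end

/-! ### Wasserstein distance, Fisher information and the law of the observation -/

section Law

variable {d : ℕ}

lemma measurable_gradient {f : EuclideanSpace ℝ (Fin d) → ℝ} : Measurable (gradient f) := by
  unfold gradient
  exact (LinearIsometryEquiv.continuous _).measurable.comp (measurable_fderiv ℝ f)

lemma measurable_denoiser (α σ : ℝ) (p : EuclideanSpace ℝ (Fin d) → ℝ) :
    Measurable (denoiser α σ p) := by
  unfold denoiser
  have h : Measurable (gradient fun z => Real.log (p z)) := measurable_gradient
  fun_prop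

lemma enorm_sq_eq_sum (v : EuclideanSpace ℝ (Fin d)) :
    ‖v‖ₑ ^ 2 = ∑ i, ENNReal.ofReal (v i ^ 2) := by
  rw [← ofReal_norm, ← ENNReal.ofReal_pow (norm_nonneg _), EuclideanSpace.real_norm_sq_eq,
    ENNReal.ofReal_sum_of_nonneg fun _ _ => sq_nonneg _]

/-- The Fisher information of the observation is at most that of the signal. -/
lemma lintegral_sq_gradient_log_noisyDensity_le {μ : Measure (Fin d → ℝ)} [IsFiniteMeasure μ]
    (hμ : μ ≠ 0) {s : Fin d → (Fin d → ℝ) → ℝ} (hs : ∀ i, MemLp (s i) 2 μ)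
    (hsc : ∀ i, IsNoisyScore μ i (s i)) {D : Fin d → ℝ} (hD : ∀ j, 0 < D j) :
    ∫⁻ y, ‖gradient (fun z : EuclideanSpace ℝ (Fin d) => Real.log (noisyDensity μ D z.ofLp))
        (WithLp.toLp 2 y)‖ₑ ^ 2 ∂(noisyLaw μ D) ≤
      ∑ i, ∫⁻ ξ, ENNReal.ofReal (s i ξ ^ 2) ∂μ := by
  have m1 := (measurable_noisyDensity_right μ D).ennreal_ofReal
  have m2 : ∀ i, Measurable fun y => ENNReal.ofReal
      (noisyPartial μ D i y ^ 2 / noisyDensity μ D y) := fun i =>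
    ((((measurable_noisyPartial μ i).comp (f := fun y => (D, y)) (by fun_prop)).pow_const 2).div
      (measurable_noisyDensity_right μ D)).ennreal_ofReal
  have m3 : Measurable fun y : Fin d → ℝ =>
      ‖gradient (fun z : EuclideanSpace ℝ (Fin d) => Real.log (noisyDensity μ D z.ofLp))
        (WithLp.toLp 2 y)‖ₑ ^ 2 :=
    (measurable_gradient.comp (PiLp.continuous_toLp 2 _).measurable).enorm.pow_const 2
  rw [noisyLaw, lintegral_withDensity_eq_lintegral_mul _ m1 m3]
  calc _ = ∫⁻ y, ∑ i, ENNReal.ofReal (noisyPartial μ D i y ^ 2 / noisyDensity μ D y) := by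
        refine lintegral_congr fun y => ?_
        have hpos := noisyDensity_pos hμ hD y
        rw [Pi.mul_apply, ← ofReal_norm, ← ENNReal.ofReal_pow (norm_nonneg _),
          sq_norm_gradient_log_noisyDensity hμ hD, ← ENNReal.ofReal_mul hpos.le,
          ← ENNReal.ofReal_sum_of_nonneg fun i _ => by positivity, Finset.mul_sum]
        congr 1
        refine Finset.sum_congr rfl fun i _ => ?_
        field_simp
    _ = ∑ i, ∫⁻ y, ENNReal.ofReal (noisyPartial μ D i y ^ 2 / noisyDensity μ D y) :=
        lintegral_finsetSum _ fun i _ => m2 i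
    _ ≤ _ := Finset.sum_le_sum fun i _ => lintegral_sq_noisyPartial_div_le (hs i) (hsc i) hD

/-- Valid for negative `x` too, since both truncations give zero; this matters because `C` carries
no sign condition. -/
lemma ofReal_rpow_half (x : ℝ) : ENNReal.ofReal x ^ (1 / 2 : ℝ) = ENNReal.ofReal (Real.sqrt x) := by
  rcases le_total 0 x with hx | hx
  · rw [ENNReal.ofReal_rpow_of_nonneg hx (by norm_num), Real.sqrt_eq_rpow]
  · rw [ENNReal.ofReal_of_nonpos hx, Real.sqrt_eq_zero_of_nonpos hx]; simp

lemma eLpNorm_two_eq {α : Type*} {m : MeasurableSpace α} {ν : Measure α}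
    {E : Type*} [NormedAddCommGroup E] (f : α → E) :
    eLpNorm f 2 ν = (∫⁻ a, ‖f a‖ₑ ^ 2 ∂ν) ^ (1 / 2 : ℝ) := by
  rw [eLpNorm_eq_lintegral_rpow_enorm_toReal two_ne_zero ENNReal.ofNat_ne_top]
  simp

/-- The joint law of `f` and `g` is a coupling. -/
lemma wasserstein_two_le_eLpNorm {α : Type*} {m : MeasurableSpace α} {ν : Measure α}
    {μ₁ μ₂ : Measure (EuclideanSpace ℝ (Fin d))} {f g : α → EuclideanSpace ℝ (Fin d)}
    (hf : Measurable f) (hg : Measurable g) (h₁ : ν.map f = μ₁) (h₂ : ν.map g = μ₂) :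
    wasserstein 2 μ₁ μ₂ ≤ eLpNorm (fun a => f a - g a) 2 ν := by
  rw [eLpNorm_two_eq, wasserstein]
  refine ENNReal.rpow_le_rpow ?_ (by norm_num)
  have hΓ : (ν.map fun a => (f a, g a)).map Prod.fst = μ₁ ∧
      (ν.map fun a => (f a, g a)).map Prod.snd = μ₂ := by
    rw [Measure.map_map measurable_fst (hf.prodMk hg),
      Measure.map_map measurable_snd (hf.prodMk hg)]
    exact ⟨h₁, h₂⟩
  refine (iInf₂_le (ν.map fun a => (f a, g a)) hΓ).trans_eq ?_
  rw [lintegral_map (by fun_prop) (hf.prodMk hg)]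
  simp

/-- Two continuous densities of the same measure coincide. -/
lemma IsDensity.eq_of_continuous {m : Measure (EuclideanSpace ℝ (Fin d))} [IsFiniteMeasure m]
    {p q : EuclideanSpace ℝ (Fin d) → ℝ} (hp : IsDensity m p) (hq : IsDensity m q)
    (hpc : Continuous p) (hqc : Continuous q) : p = q := by
  have h := hp.2.2.symm.trans hq.2.2
  have hfin : ∫⁻ x, ENNReal.ofReal (p x) ≠ ∞ := by
    have h1 : m Set.univ ≠ ∞ := measure_ne_top m _
    rwa [hp.2.2, withDensity_apply _ MeasurableSet.univ, setLIntegral_univ] at h1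
  rw [withDensity_eq_iff hp.1.ennreal_ofReal.aemeasurable hq.1.ennreal_ofReal.aemeasurable hfin]
    at h
  refine Continuous.ae_eq_iff_eq (volume : Measure (EuclideanSpace ℝ (Fin d))) hpc hqc |>.1 ?_
  filter_upwards [h] with x hx
  exact (ENNReal.ofReal_eq_ofReal_iff (hp.2.1 x) (hq.2.1 x)).1 hx

lemma isDensity_map_noisyLaw (μ : Measure (Fin d → ℝ)) [IsFiniteMeasure μ] {D : Fin d → ℝ}
    (hD : ∀ j, 0 < D j) :
    IsDensity ((noisyLaw μ D).map (WithLp.toLp 2)) fun y => noisyDensity μ D y.ofLp := by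
  refine ⟨(continuous_noisyDensity μ hD).measurable, fun y => noisyDensity_nonneg _ _ _, ?_⟩
  have m1 := (measurable_noisyDensity_right μ D).ennreal_ofReal
  have hL : Measurable (WithLp.toLp 2 : (Fin d → ℝ) → EuclideanSpace ℝ (Fin d)) :=
    (PiLp.continuous_toLp 2 _).measurable
  refine Measure.ext_of_lintegral _ fun f hf => ?_
  have m2 : Measurable fun y : Fin d → ℝ => f (WithLp.toLp 2 y) := hf.comp hL
  rw [lintegral_map hf hL, noisyLaw, lintegral_withDensity_eq_lintegral_mul _ m1 m2,
    lintegral_withDensity_eq_lintegral_mul _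
      (continuous_noisyDensity μ hD).measurable.ennreal_ofReal hf,
    ← (EuclideanSpace.volume_preserving_symm_measurableEquiv_toLp (Fin d)).lintegral_comp_emb
      (MeasurableEquiv.measurableEmbedding _)]
  rfl

/-- The law of `X + ε` for independent Gaussian noise `ε`. -/
lemma map_add_eq_map_noisyLaw {Ω : Type*} [MeasurableSpace Ω] {P : Measure Ω}
    [IsProbabilityMeasure P] {X ε : Ω → EuclideanSpace ℝ (Fin d)} (hX : AEMeasurable X P)
    {r : ℝ} (hr : 0 < r)
    (hε : HasLaw ε (multivariateGaussian 0 (r • (1 : Matrix (Fin d) (Fin d) ℝ))) P)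
    (hXε : IndepFun X ε P) :
    P.map (fun ω => X ω + ε ω) =
      (noisyLaw ((P.map X).map WithLp.ofLp) fun _ => r).map (WithLp.toLp 2) := by
  have hL : Measurable (WithLp.toLp 2 : (Fin d → ℝ) → EuclideanSpace ℝ (Fin d)) :=
    (PiLp.continuous_toLp 2 _).measurable
  have hO : Measurable (WithLp.ofLp : EuclideanSpace ℝ (Fin d) → (Fin d → ℝ)) :=
    (PiLp.continuous_ofLp 2 _).measurable
  have : IsProbabilityMeasure (P.map X) := Measure.isProbabilityMeasure_map hX
  have h1 : P.map (fun ω => (X ω, ε ω)) = (P.map X).prod (P.map ε) :=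
    (indepFun_iff_map_prod_eq_prod_map_map hX hε.aemeasurable).1 hXε
  have hadd : Measurable fun q : EuclideanSpace ℝ (Fin d) × EuclideanSpace ℝ (Fin d) =>
      q.1 + q.2 := by fun_prop
  have h2 : P.map (fun ω => X ω + ε ω) =
      (P.map (fun ω => (X ω, ε ω))).map (fun q => q.1 + q.2) :=
    (AEMeasurable.map_map_of_aemeasurable hadd.aemeasurable (hX.prodMk hε.aemeasurable)).symm
  have h3 : P.map X = ((P.map X).map WithLp.ofLp).map (WithLp.toLp 2) := by
    rw [Measure.map_map hL hO]; exact Measure.map_id.symm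
  rw [h2, h1, hε.map_eq, multivariateGaussian_eq_map_isoGaussian hr.le]
  nth_rewrite 1 [h3]
  rw [Measure.map_prod_map _ _ hL hL, Measure.map_map (by fun_prop) (by fun_prop),
    ← map_add_isoGaussian _ hr, Measure.map_map hL (by fun_prop)]
  rfl

end Law

end

/-! ### The main estimate -/

theorem proposition2 {d : ℕ} {Ω : Type*} [MeasurableSpace Ω] (P : Measure Ω)
    [IsProbabilityMeasure P]
    (X ε : Ω → EuclideanSpace ℝ (Fin d)) (hX : AEMeasurable X P)
    (σ : ℝ) (hσ : 0 < σ)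
    (hε : HasLaw ε
      (multivariateGaussian 0 (σ ^ 2 • (1 : Matrix (Fin d) (Fin d) ℝ))) P)
    (hXε : IndepFun X ε P)
    (pX : EuclideanSpace ℝ (Fin d) → ℝ) (hpX : IsDensity (P.map X) pX)
    (sX : EuclideanSpace ℝ (Fin d) → EuclideanSpace ℝ (Fin d)) (hsX : IsScore pX sX)
    (C : ℝ) (hC : ∫⁻ ω, ‖sX (X ω)‖ₑ ^ 2 ∂P ≤ ENNReal.ofReal C)
    (pY : EuclideanSpace ℝ (Fin d) → ℝ) (hpY : IsDensity (P.map (fun ω => X ω + ε ω)) pY)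
    (hpYc : Continuous pY)
    (α : ℝ) :
    wasserstein 2 (P.map X) (P.map (fun ω => denoiser α σ pY (X ω + ε ω))) ≤
      ENNReal.ofReal (Real.sqrt ((1 + 4 * α ^ 2) * C / 2) * σ ^ 2) := by
  have hL : Measurable (WithLp.toLp 2 : (Fin d → ℝ) → EuclideanSpace ℝ (Fin d)) :=
    (PiLp.continuous_toLp 2 _).measurable
  have hO : Measurable (WithLp.ofLp : EuclideanSpace ℝ (Fin d) → (Fin d → ℝ)) :=
    (PiLp.continuous_ofLp 2 _).measurable
  have hm : IsProbabilityMeasure (P.map X) := Measure.isProbabilityMeasure_map hX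
  -- The transport lives on `Fin d → ℝ`, where Lebesgue measure is a product and coordinates can be
  -- integrated separately.
  set μ : Measure (Fin d → ℝ) := (P.map X).map WithLp.ofLp with hμdef
  have hμp : IsProbabilityMeasure μ := Measure.isProbabilityMeasure_map hO.aemeasurable
  have hμ : μ ≠ 0 := IsProbabilityMeasure.ne_zero μ
  have hb : 0 < σ ^ 2 := by positivity
  have hD : ∀ _ : Fin d, 0 < σ ^ 2 := fun _ => hb
  have hmX : μ.map (WithLp.toLp 2) = P.map X := by
    rw [hμdef, Measure.map_map hL hO]; exact Measure.map_id
  -- the score of the signal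
  have hsm : AEStronglyMeasurable sX (P.map X) := hsX.aestronglyMeasurable hpX
  have hC' : ∫⁻ x, ‖sX x‖ₑ ^ 2 ∂(P.map X) ≤ ENNReal.ofReal C := by
    rwa [lintegral_map' (hsm.enorm.pow_const 2) hX]
  have hsL : MemLp sX 2 (P.map X) := by
    refine ⟨hsm, ?_⟩
    rw [eLpNorm_two_eq]
    exact ENNReal.rpow_lt_top_of_nonneg (by norm_num)
      (hC'.trans_lt ENNReal.ofReal_lt_top).ne
  set s : Fin d → (Fin d → ℝ) → ℝ := fun i ξ => sX (WithLp.toLp 2 ξ) i with hsdef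
  have hmp : MeasurePreserving (WithLp.toLp 2) μ (P.map X) := ⟨hL, hmX⟩
  have hsLp : ∀ i, MemLp (s i) 2 μ := fun i =>
    (MemLp.eval_piLp hsL i).comp_measurePreserving hmp
  have hsc : ∀ i, IsNoisyScore μ i (s i) := fun i =>
    hsX.isNoisyScore hpX (hsL.integrable one_le_two) i
  have hI : ∑ i, ∫⁻ ξ, ENNReal.ofReal (s i ξ ^ 2) ∂μ ≤ ENNReal.ofReal C := by
    rw [← lintegral_finsetSum' _ fun i _ =>
      ((hsLp i).aestronglyMeasurable.aemeasurable.pow_const 2).ennreal_ofReal]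
    refine le_trans (le_of_eq ?_) hC'
    rw [← hmX, lintegral_map' (by rw [hmX]; exact hsm.enorm.pow_const 2) hL.aemeasurable]
    exact lintegral_congr fun ξ => (enorm_sq_eq_sum _).symm
  -- the law and the density of the observation
  have hY := map_add_eq_map_noisyLaw hX hb hε hXε
  rw [← hμdef] at hY
  have hYm : AEMeasurable (fun ω => X ω + ε ω) P := hX.add hε.aemeasurable
  have : IsProbabilityMeasure (P.map fun ω => X ω + ε ω) := Measure.isProbabilityMeasure_map hYm
  -- Continuity pins the density down at every point, so that its gradient is the explicit one.
  have hpYeq : pY = fun y => noisyDensity μ (fun _ => σ ^ 2) y.ofLp :=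
    hpY.eq_of_continuous (hY ▸ isDensity_map_noisyLaw μ hD) hpYc (continuous_noisyDensity μ hD)
  have hφ := measurable_denoiser α σ pY
  have hfisher := lintegral_sq_gradient_log_noisyDensity_le hμ hsLp hsc hD
  set gY : EuclideanSpace ℝ (Fin d) → EuclideanSpace ℝ (Fin d) :=
    gradient fun z => Real.log (pY z) with hgY
  have hgYm : Measurable gY := measurable_gradient
  have hfisherY : ∫⁻ y, ‖gY (WithLp.toLp 2 y)‖ₑ ^ 2 ∂(noisyLaw μ fun _ => σ ^ 2) ≤
      ENNReal.ofReal C := by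
    rw [hgY, hpYeq]; exact hfisher.trans hI
  set K := ENNReal.ofReal (Real.sqrt ((1 + 4 * α ^ 2) * C / 2) * σ ^ 2) with hK
  -- the bound up to a small regularization of the signal
  have key : ∀ a, 0 < a → a ≤ σ ^ 2 →
      wasserstein 2 (P.map X) (P.map (fun ω => denoiser α σ pY (X ω + ε ω))) ≤
        ENNReal.ofReal (Real.sqrt (d * a)) + K := by
    intro a ha hab
    obtain ⟨T, hT, hTmap, hTcost⟩ := exists_transport hμ hsLp hsc ha hab
    -- The coupling: `q.1` is the signal, `q.2` a small independent noise, and `T (q.1 + q.2)` has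
    -- the law of `Y`.
    set ν := μ.prod (isoGaussian (Fin d) a) with hν
    have hadd : ν.map (fun q => q.1 + q.2) = noisyLaw μ fun _ => a := map_add_isoGaussian μ ha
    have madd : Measurable fun q : (Fin d → ℝ) × (Fin d → ℝ) => q.1 + q.2 := by fun_prop
    have mF : Measurable fun w => denoiser α σ pY (WithLp.toLp 2 (T w)) :=
      hφ.comp (hL.comp hT)
    have h1 : ν.map (fun q => WithLp.toLp 2 q.1) = P.map X := by
      have : ν.map Prod.fst = μ := by rw [hν, Measure.map_fst_prod]; simp
      rw [← hmX, ← this, Measure.map_map hL measurable_fst]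
      rfl
    have h2 : ν.map (fun q => denoiser α σ pY (WithLp.toLp 2 (T (q.1 + q.2)))) =
        P.map (fun ω => denoiser α σ pY (X ω + ε ω)) := by
      have e1 : P.map (fun ω => denoiser α σ pY (X ω + ε ω)) =
          (P.map (fun ω => X ω + ε ω)).map (denoiser α σ pY) :=
        (AEMeasurable.map_map_of_aemeasurable hφ.aemeasurable hYm).symm
      rw [e1, hY, ← hTmap, ← hadd, Measure.map_map hT madd, Measure.map_map hL (hT.comp madd),
        Measure.map_map hφ (hL.comp (hT.comp madd))]
      rfl
    refine (wasserstein_two_le_eLpNorm (hL.comp measurable_fst) (mF.comp madd) h1 h2).trans ?_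
    -- The signal is the slightly noisy signal minus its noise; by Minkowski the noise contributes
    -- at most `√(d a)`.
    have hsplit : (fun q : (Fin d → ℝ) × (Fin d → ℝ) => WithLp.toLp 2 q.1 -
        denoiser α σ pY (WithLp.toLp 2 (T (q.1 + q.2)))) =
        (fun q => -WithLp.toLp 2 q.2) + fun q => WithLp.toLp 2 (q.1 + q.2) -
          denoiser α σ pY (WithLp.toLp 2 (T (q.1 + q.2))) := by
      ext q
      simp
      ring
    have mG : Measurable fun w : Fin d → ℝ => WithLp.toLp 2 w -
          denoiser α σ pY (WithLp.toLp 2 (T w)) := hL.sub mF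
    change eLpNorm (fun q : (Fin d → ℝ) × (Fin d → ℝ) => WithLp.toLp 2 q.1 -
        denoiser α σ pY (WithLp.toLp 2 (T (q.1 + q.2)))) 2 ν ≤ _
    rw [hsplit]
    have mN : Measurable fun q : (Fin d → ℝ) × (Fin d → ℝ) =>
        (-WithLp.toLp 2 q.2 : EuclideanSpace ℝ (Fin d)) := (hL.comp measurable_snd).neg
    have mGadd : Measurable fun q : (Fin d → ℝ) × (Fin d → ℝ) => WithLp.toLp 2 (q.1 + q.2) -
          denoiser α σ pY (WithLp.toLp 2 (T (q.1 + q.2))) := mG.comp madd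
    refine (eLpNorm_add_le mN.aestronglyMeasurable mGadd.aestronglyMeasurable one_le_two).trans
      (add_le_add ?_ ?_)
    · rw [eLpNorm_two_eq, ← ofReal_rpow_half]
      gcongr
      have e1 := lintegral_sum_sq_isoGaussian (ι := Fin d) ha.le
      have e2 : ν.map Prod.snd = isoGaussian (Fin d) a := by
        rw [hν, Measure.map_snd_prod]; simp
      rw [← e2, lintegral_map (by fun_prop) measurable_snd, Fintype.card_fin] at e1
      refine le_trans (le_of_eq (lintegral_congr fun q => ?_)) e1.le
      rw [← enorm_neg, enorm_sq_eq_sum]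
      simp
    · have e1 : eLpNorm (fun q : (Fin d → ℝ) × (Fin d → ℝ) => WithLp.toLp 2 (q.1 + q.2) -
          denoiser α σ pY (WithLp.toLp 2 (T (q.1 + q.2)))) 2 ν =
          eLpNorm (fun w => WithLp.toLp 2 w - denoiser α σ pY (WithLp.toLp 2 (T w))) 2
            (noisyLaw μ fun _ => a) := by
        rw [← hadd, eLpNorm_map_measure mG.aestronglyMeasurable madd.aemeasurable]
        rfl
      have hKeq : K = ENNReal.ofReal ((1 + 4 * α ^ 2) / 2 * σ ^ 4 * C) ^ (1 / 2 : ℝ) := by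
        rw [ofReal_rpow_half, hK]
        congr 1
        have : (1 + 4 * α ^ 2) / 2 * σ ^ 4 * C = (1 + 4 * α ^ 2) * C / 2 * (σ ^ 2) ^ 2 := by ring
        rw [this, Real.sqrt_mul' _ (by positivity), Real.sqrt_sq hb.le]
      rw [e1, eLpNorm_two_eq, hKeq]
      gcongr
      have mg : Measurable fun w => ‖gY (WithLp.toLp 2 (T w))‖ₑ ^ 2 :=
        (hgYm.comp (hL.comp hT)).enorm.pow_const 2
      have mT : Measurable fun w => ∑ i, ENNReal.ofReal ((T w i - w i) ^ 2) :=
        Finset.measurable_fun_sum _ fun i _ => ((((measurable_pi_apply i).comp hT).sub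
          (measurable_pi_apply i)).pow_const 2).ennreal_ofReal
      -- The displacement by `T` and the score correction are separated by `‖u + v‖² ≤ 2 ‖u‖² + 2
      -- ‖v‖²`.
      have hpt : ∀ w : Fin d → ℝ,
          ‖WithLp.toLp 2 w - denoiser α σ pY (WithLp.toLp 2 (T w))‖ₑ ^ 2 ≤
          ENNReal.ofReal 2 * ∑ i, ENNReal.ofReal ((T w i - w i) ^ 2) +
            ENNReal.ofReal (2 * (α * σ ^ 2) ^ 2) * ‖gY (WithLp.toLp 2 (T w))‖ₑ ^ 2 := by
        intro w
        have n1 : ‖WithLp.toLp 2 w - denoiser α σ pY (WithLp.toLp 2 (T w))‖ ^ 2 ≤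
            2 * ‖WithLp.toLp 2 (T w - w)‖ ^ 2 +
              2 * (α * σ ^ 2) ^ 2 * ‖gY (WithLp.toLp 2 (T w))‖ ^ 2 := by
          have e : WithLp.toLp 2 w - denoiser α σ pY (WithLp.toLp 2 (T w)) =
              -(WithLp.toLp 2 (T w - w) + (α * σ ^ 2) • gY (WithLp.toLp 2 (T w))) := by
            rw [denoiser, WithLp.toLp_sub]; abel
          rw [e, norm_neg]
          have n2 := norm_add_le (WithLp.toLp 2 (T w - w) : EuclideanSpace ℝ (Fin d))
            ((α * σ ^ 2) • gY (WithLp.toLp 2 (T w)))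
          have n3 : ‖(α * σ ^ 2) • gY (WithLp.toLp 2 (T w))‖ ^ 2 =
              (α * σ ^ 2) ^ 2 * ‖gY (WithLp.toLp 2 (T w))‖ ^ 2 := by
            rw [norm_smul, mul_pow, Real.norm_eq_abs, sq_abs]
          rw [mul_assoc, ← n3]
          refine (pow_le_pow_left₀ (norm_nonneg _) n2 2).trans ?_
          nlinarith [sq_nonneg (‖(WithLp.toLp 2 (T w - w) : EuclideanSpace ℝ (Fin d))‖ -
            ‖(α * σ ^ 2) • gY (WithLp.toLp 2 (T w))‖)]
        have n4 := enorm_sq_eq_sum (WithLp.toLp 2 (T w - w))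
        simp only [Pi.sub_apply] at n4
        rw [← n4, ← ofReal_norm, ← ofReal_norm, ← ofReal_norm, ← ENNReal.ofReal_pow (norm_nonneg _),
          ← ENNReal.ofReal_pow (norm_nonneg _), ← ENNReal.ofReal_pow (norm_nonneg _),
          ← ENNReal.ofReal_mul (by norm_num), ← ENNReal.ofReal_mul (by positivity),
          ← ENNReal.ofReal_add (by positivity) (by positivity)]
        exact ENNReal.ofReal_le_ofReal n1
      -- `T` pushes the law at variance `a` to the law of `Y`, so this is the Fisher information of
      -- `Y`.
      have hg2 : ∫⁻ w, ‖gY (WithLp.toLp 2 (T w))‖ₑ ^ 2 ∂(noisyLaw μ fun _ => a) ≤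
          ENNReal.ofReal C := by
        have mgY : Measurable fun y : Fin d → ℝ => ‖gY (WithLp.toLp 2 y)‖ₑ ^ 2 :=
          (hgYm.comp hL).enorm.pow_const 2
        rw [← hTmap, lintegral_map mgY hT] at hfisherY
        exact hfisherY
      have hT2 : ∫⁻ w, ∑ i, ENNReal.ofReal ((T w i - w i) ^ 2) ∂(noisyLaw μ fun _ => a) ≤
          ENNReal.ofReal (σ ^ 4 / 4) * ENNReal.ofReal C := by
        refine hTcost.trans (mul_le_mul' (ENNReal.ofReal_le_ofReal ?_) hI)
        have : (σ ^ 2 - a) ^ 2 ≤ (σ ^ 2) ^ 2 :=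
          pow_le_pow_left₀ (by linarith) (by linarith) 2
        nlinarith
      calc _ ≤ ∫⁻ w, (ENNReal.ofReal 2 * ∑ i, ENNReal.ofReal ((T w i - w i) ^ 2) +
            ENNReal.ofReal (2 * (α * σ ^ 2) ^ 2) * ‖gY (WithLp.toLp 2 (T w))‖ₑ ^ 2)
              ∂(noisyLaw μ fun _ => a) := lintegral_mono hpt
        _ ≤ ENNReal.ofReal 2 * (ENNReal.ofReal (σ ^ 4 / 4) * ENNReal.ofReal C) +
            ENNReal.ofReal (2 * (α * σ ^ 2) ^ 2) * ENNReal.ofReal C := by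
            rw [lintegral_add_left (mT.const_mul _), lintegral_const_mul _ mT,
              lintegral_const_mul _ mg]
            gcongr
        -- The constant is `2 · σ⁴ / 4 + 2 α² σ⁴`.
        _ = ENNReal.ofReal ((1 + 4 * α ^ 2) / 2 * σ ^ 4 * C) := by
            rw [← mul_assoc, ← ENNReal.ofReal_mul (by norm_num), ← add_mul,
              ← ENNReal.ofReal_add (by positivity) (by positivity),
              ← ENNReal.ofReal_mul (by positivity)]
            congr 1
            ring
  have hlim : Filter.Tendsto (fun a : ℝ => ENNReal.ofReal (Real.sqrt (d * a)) + K)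
      (nhdsWithin 0 (Set.Ioi 0)) (nhds K) := by
    have hc : Continuous fun a : ℝ => ENNReal.ofReal (Real.sqrt (d * a)) + K :=
      (ENNReal.continuous_ofReal.comp (by fun_prop)).add continuous_const
    have := hc.tendsto 0
    simp only [mul_zero, Real.sqrt_zero, ENNReal.ofReal_zero, zero_add] at this
    exact this.mono_left nhdsWithin_le_nhds
  refine ge_of_tendsto hlim ?_
  filter_upwards [Ioc_mem_nhdsGT hb] with a ha using key a ha.1 ha.2
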